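/- A graph here is finite and consists of a vertex set $V$, a set $E^{\mathrm{dir}}$ of directed edges with tail and head maps $t,h\colon E^{\mathrm{dir}}\to V$, and an involution $\iota$ of $E^{\mathrm{dir}}$ with $t\iota=h$; multiple edges, whole-loops (self-loops with $\iota e\ne e$) and half-loops ($\iota e=e$) are allowed. The degree of a vertex is the number of directed edges with that tail, the adjacency matrix counts directed edges, and its eigenvalues, with multiplicity, are written $\lambda_1(G)\ge\lambda_2(G)\ge\dots\ge\lambda_{|V_G|}(G)$. For $n\ge 1$, $\mathcal C_n(B)$ is the following random cover $G$ of degree $n$ of $B$: choose permutations $\sigma_e$ of $\{1,\dots,n\}$ with $\sigma_{\iota e}=\sigma_e^{-1}$, independently over the pairs $\{e,\iota e\}$, where $\sigma_e$ is uniform over all permutations if $e$ is not a half-loop, and, if $e$ is a half-loop, uniform over the involutions with no fixed point ($n$ even) or with exactly one fixed point ($n$ odd). The vertices of $G$ are $V_B\times\{1,\dots,n\}$, its directed edges are $E^{\mathrm{dir}}_B\times\{1,\dots,n\}$, the edge $(e,i)$ goes from $(t(e),i)$ to $(h(e),\sigma_e(i))$, and its opposite edge is $(\iota e,\sigma_e(i))$.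 Theorem. Let $B$ be a connected $d$-regular graph with $d\ge 3$. For every integer $j>0$ there are $\epsilon>0$, $C>0$ and an integer $r$ (depending only on $B$ and $j$) such that for all $n\ge 1$: 1. if $B$ is not bipartite, then the probability that $G\in\mathcal C_n(B)$ has no connected component with fewer than $r$ vertices and satisfies $|\lambda_i(G)|\ge d-\epsilon$ for some $i>1$ is at most $Cn^{-j}$; 2. if $B$ is bipartite, then the probability that $G\in\mathcal C_n(B)$ has no connected component with fewer than $r$ vertices and satisfies $|\lambda_i(G)|\ge d-\epsilon$ for some $i\ne 1,|V_G|$ is at most $Cn^{-j}$. -/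

import Mathlib

open MeasureTheory ProbabilityTheory

universe u v

/-- A graph with vertex type `V` and directed edge type `E`: tail and head maps, and an involution
`inv` (the opposite map) with `tail ∘ inv = head`. Multiple edges are allowed, and so are
self-loops, both whole-loops (`inv e ≠ e`) and half-loops (`inv e = e`). -/
structure MultiGraph (V : Type u) (E : Type v) where
  tail : E → V
  head : E → V
  inv : E → E
  inv_inv : ∀ e, inv (inv e) = e
  tail_inv : ∀ e, tail (inv e) = head e

namespace MultiGraph

variable {V : Type u} {E : Type v}

lemma head_inv (G : MultiGraph V E) (e : E) : G.head (G.inv e) = G.tail e := by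
  rw [← G.tail_inv (G.inv e), G.inv_inv]

/-- A half-loop is a directed edge fixed by the involution (it is then a self-loop). -/
def IsHalfLoop (G : MultiGraph V E) (e : E) : Prop := G.inv e = e

/-- The degree of a vertex: the number of directed edges with that tail (equivalently, head).
A whole-loop contributes two to the degree, a half-loop one. -/
noncomputable def degree (G : MultiGraph V E) (x : V) : ℕ := Nat.card {e : E // G.tail e = x}

def IsRegular (G : MultiGraph V E) (d : ℕ) : Prop := ∀ x, G.degree x = d

/-- Some edge goes from `x` to `y`. -/
def Adj (G : MultiGraph V E) (x y : V) : Prop := ∃ e, G.tail e = x ∧ G.head e = y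

/-- There is a walk from `x` to `y`. -/
def Reachable (G : MultiGraph V E) (x y : V) : Prop := Relation.ReflTransGen G.Adj x y

def IsConnected (G : MultiGraph V E) : Prop := Nonempty V ∧ ∀ x y, G.Reachable x y

/-- The vertex set of the connected component of `x`. -/
def component (G : MultiGraph V E) (x : V) : Set V := {y | G.Reachable x y}

/-- The vertices can be split in two classes such that every edge joins one class to the other. -/
def IsBipartite (G : MultiGraph V E) : Prop := ∃ c : V → Bool, ∀ e, c (G.tail e) ≠ c (G.head e)

/-- The adjacency matrix; its `(x, y)` entry is the number of directed edges from `x` to `y`. -/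
noncomputable def adjMatrix (G : MultiGraph V E) : Matrix V V ℝ :=
  fun x y => (Nat.card {e : E // G.tail e = x ∧ G.head e = y} : ℝ)

lemma adjMatrix_isHermitian (G : MultiGraph V E) : G.adjMatrix.IsHermitian := by
  ext x y
  simp only [Matrix.conjTranspose_apply, star_trivial, adjMatrix]
  congr 1
  refine Nat.card_congr ⟨fun e => ⟨G.inv e.1, ?_, ?_⟩, fun e => ⟨G.inv e.1, ?_, ?_⟩, ?_, ?_⟩
  · rw [G.tail_inv]; exact e.2.2
  · rw [G.head_inv]; exact e.2.1
  · rw [G.tail_inv]; exact e.2.2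
  · rw [G.head_inv]; exact e.2.1
  · intro e; exact Subtype.ext (G.inv_inv e.1)
  · intro e; exact Subtype.ext (G.inv_inv e.1)

/-- The adjacency eigenvalues with multiplicity, in decreasing order and indexed from zero:
`G.eigenvalue i` is usually written `λ_{i+1}(G)`. -/
noncomputable def eigenvalue [Fintype V] [DecidableEq V] (G : MultiGraph V E)
    (i : Fin (Fintype.card V)) : ℝ :=
  G.adjMatrix_isHermitian.eigenvalues₀ i

/-- A permutation assignment of degree `n`: a permutation of an `n`-element set for every directed
edge, with inverse permutations on opposite edges. -/
def PermAssignment (B : MultiGraph V E) (n : ℕ) : Type v :=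
  {σ : E → Equiv.Perm (Fin n) // ∀ e, σ (B.inv e) = (σ e)⁻¹}

instance (B : MultiGraph V E) (n : ℕ) : MeasurableSpace (B.PermAssignment n) := ⊤

instance (B : MultiGraph V E) (n : ℕ) : MeasurableSingletonClass (B.PermAssignment n) :=
  ⟨fun _ => trivial⟩

instance [Finite E] (B : MultiGraph V E) (n : ℕ) : Finite (B.PermAssignment n) :=
  inferInstanceAs (Finite {σ : E → Equiv.Perm (Fin n) // ∀ e, σ (B.inv e) = (σ e)⁻¹})

/-- The cover of `B` of degree `n` that a permutation assignment determines: the edge `(e, i)` goes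
from `(tail e, i)` to `(head e, σ e i)`. -/
def cover (B : MultiGraph V E) {n : ℕ} (σ : B.PermAssignment n) :
    MultiGraph (V × Fin n) (E × Fin n) where
  tail p := (B.tail p.1, p.2)
  head p := (B.head p.1, σ.1 p.1 p.2)
  inv p := (B.inv p.1, σ.1 p.1 p.2)
  inv_inv p := by simp [B.inv_inv, σ.2]
  tail_inv p := by simp [B.tail_inv]

/-- The assignments that the random model allows: on a half-loop the permutation (necessarily an
involution) has no fixed point if `n` is even and exactly one if `n` is odd. -/
def admissible (B : MultiGraph V E) (n : ℕ) : Set (B.PermAssignment n) :=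
  {σ | ∀ e, B.IsHalfLoop e →
    (Even n → ∀ i, σ.1 e i ≠ i) ∧ (Odd n → ∃! i, σ.1 e i = i)}

lemma admissible_nonempty (B : MultiGraph V E) (n : ℕ) : (B.admissible n).Nonempty := by
  refine ⟨⟨fun _ => Fin.revPerm, fun _ => ?_⟩, fun e _ => ⟨fun hn i h => ?_, fun hn => ?_⟩⟩
  · ext i; simp [Equiv.Perm.inv_def]
  · have := congrArg Fin.val h
    simp only [Fin.revPerm_apply, Fin.val_rev] at this
    obtain ⟨k, rfl⟩ := hn
    omega
  · obtain ⟨k, rfl⟩ := hn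
    refine ⟨⟨k, by omega⟩, ?_, fun i h => ?_⟩
    · apply Fin.ext
      simp only [Fin.revPerm_apply, Fin.val_rev]
      omega
    · have := congrArg Fin.val h
      simp only [Fin.revPerm_apply, Fin.val_rev] at this
      apply Fin.ext
      simp only
      omega

/-- The Broder-Shamir model of degree `n` over `B`. The admissible assignments form a product, with
one factor for every pair `{e, inv e}`: all of the symmetric group if `e` is not a half-loop, and
the involutions with no fixed point (`n` even) or one fixed point (`n` odd) if `e` is a half-loop.
So the uniform law on them chooses each factor uniformly and independently of the others. -/
noncomputable def broderShamir (B : MultiGraph V E) (n : ℕ) : Measure (B.PermAssignment n) :=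
  uniformOn (B.admissible n)

instance [Finite E] (B : MultiGraph V E) (n : ℕ) : IsProbabilityMeasure (B.broderShamir n) :=
  isProbabilityMeasure_uniformOn (Set.toFinite _) (B.admissible_nonempty n)

end MultiGraph

/-! The argument is a first-moment bound on sparse cuts. By a discrete Cheeger inequality, a
nontrivial eigenvalue near `d` yields a set of at most half the vertices of the cover with few
boundary edges; one near `-d` yields such a set or a cut that almost all edges cross. If `B` is
bipartite, a sign flip on one class reduces the second case to the first
(`IsEigenfunction.mul_sign`). Read fibre by fibre, the set is a 2-colouring that every `σ e` nearly
preserves, or nearly reverses. Connectedness, respectively non-bipartiteness, of `B` then gives a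
fibre in which both colours occur at least `m ≥ m₀` times while all discrepancies are at most `m /
q`; excluding small components forces `m ≥ m₀` when the boundary is empty
(`exists_nearly_preserved_of_eigenvalue`).

Fix a colouring with weights `w_v` and write `β = ballCard n k`. By symmetry under relabelling, a
uniform permutation has discrepancy at most `k` with probability at most `β / n.choose w`, where `w`
is the weight at either end. The involution on a half-loop gives only about the square root of this.
Taking the geometric mean of the two ends of every other edge puts all directed edges on the same
footing: the squared probability is at most a polynomial times `β ^ (2|E|)` divided by `P ^ d`,
where `P` is the product of the `n.choose w_v` (`sq_broderShamir_discrepancy_le`, `prod_edgeBound`).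

Since `d ≥ 3`, the probability carries at least `P ^ (-3/2)`. One factor `P⁻¹` pays for the union
bound, because its sum over all colourings is only `(n + 1) ^ |V|`. The remaining square root
absorbs `β` and all powers of `n`, because `n.choose m` outgrows any fixed power of both once `q`
and `m₀` are large (`exists_poly_mul_ballCard_pow_le_choose`). -/

/-- The number of elements that a colouring maps to `true`. -/
def weight {α : Type*} [Fintype α] (x : α → Bool) : ℕ :=
  (Finset.univ.filter fun i => x i = true).card

/-- The number of colourings of an `n`-element set with at most `k` elements `true`. -/
def ballCard (n k : ℕ) : ℕ :=
  (Finset.univ.filter fun w : Fin n → Bool => weight w ≤ k).card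

/-- The elements at which `σ` fails to carry `x` to `y` (`b = false`), or to the complement of `y`
(`b = true`). -/
def discrepancy {n : ℕ} (b : Bool) (σ : Equiv.Perm (Fin n)) (x y : Fin n → Bool) : Fin n → Bool :=
  fun i => (x i ^^ y (σ i)) ^^ b

/-! ### Counting permutations that nearly preserve a colouring -/

lemma weight_le_card {α : Type*} [Fintype α] (x : α → Bool) : weight x ≤ Fintype.card α :=
  Finset.card_le_univ _

lemma weight_le {n : ℕ} (x : Fin n → Bool) : weight x ≤ n := by
  simpa using weight_le_card x

lemma weight_not {n : ℕ} (x : Fin n → Bool) : weight (fun i => !x i) = n - weight x := by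
  have h := Finset.card_filter_add_card_filter_not (s := (Finset.univ : Finset (Fin n)))
    (fun i => x i = true)
  simp only [Finset.card_univ, Fintype.card_fin] at h
  have h' : weight (fun i => !x i) = (Finset.univ.filter fun i => ¬ x i = true).card := by
    unfold weight; congr 1; ext i; simp
  have h'' : weight x = (Finset.univ.filter fun i => x i = true).card := rfl
  omega

lemma weight_comp_perm {n : ℕ} (x : Fin n → Bool) (π : Equiv.Perm (Fin n)) :
    weight (x ∘ π) = weight x := by
  refine Finset.card_bij (fun i _ => π i) ?_ ?_ ?_
  · intro i hi; simpa using hi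
  · intro i _ j _ h; exact π.injective h
  · intro j hj; exact ⟨π.symm j, by simpa using hj, by simp⟩

lemma one_le_ballCard (n k : ℕ) : 1 ≤ ballCard n k := by
  refine Finset.card_pos.2 ⟨fun _ => false, ?_⟩
  rw [Finset.mem_filter]
  simp [weight]

lemma card_filter_weight_eq (n a : ℕ) :
    (Finset.univ.filter fun x : Fin n → Bool => weight x = a).card = n.choose a := by
  have h := Finset.card_powersetCard a (Finset.univ : Finset (Fin n))
  rw [Finset.card_univ, Fintype.card_fin] at h
  rw [← h]
  refine Finset.card_nbij' (fun x => Finset.univ.filter fun i => x i = true)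
    (fun s i => decide (i ∈ s)) ?_ ?_ ?_ ?_
  · intro x hx
    rw [Finset.mem_coe, Finset.mem_filter] at hx
    simpa [Finset.mem_powersetCard, weight] using hx.2
  · intro s hs
    rw [Finset.mem_coe, Finset.mem_powersetCard] at hs
    rw [Finset.mem_coe, Finset.mem_filter]
    simpa [weight] using hs.2
  · intro x _; ext i; simp
  · intro s _; ext i; simp

lemma exists_perm_comp_eq {n : ℕ} {x y : Fin n → Bool} (h : weight x = weight y) :
    ∃ π : Equiv.Perm (Fin n), y ∘ π = x := by
  have hc : Fintype.card {i // x i = true} = Fintype.card {i // y i = true} := by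
    rw [Fintype.card_subtype, Fintype.card_subtype]; exact h
  let e := Fintype.equivOfCardEq hc
  refine ⟨e.extendSubtype, funext fun i => ?_⟩
  by_cases hi : x i = true
  · rw [Function.comp_apply, e.extendSubtype_mem i hi, hi]
  · have := e.extendSubtype_not_mem i hi
    simp only [Bool.not_eq_true] at hi this
    rw [Function.comp_apply, this, hi]

/-- Double counting of pairs `(x', σ)` with `x'` of the same weight as `x`. Right multiplication by
a permutation shows that every `x'` has the same number of `σ`; conversely `σ`, `y` and the
discrepancy determine `x'`, so each `σ` occurs with at most `ballCard n k` colourings. -/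
lemma card_perm_discrepancy_mul_choose {n : ℕ} (b : Bool) (k : ℕ) (x y : Fin n → Bool) :
    (Finset.univ.filter fun σ : Equiv.Perm (Fin n) => weight (discrepancy b σ x y) ≤ k).card *
      n.choose (weight x) ≤ ballCard n k * Fintype.card (Equiv.Perm (Fin n)) := by
  classical
  set X := Finset.univ.filter fun x' : Fin n → Bool => weight x' = weight x with hX
  have hsum := Finset.sum_card_bipartiteAbove_eq_sum_card_bipartiteBelow (s := X)
    (t := (Finset.univ : Finset (Equiv.Perm (Fin n))))
    (fun x' σ => weight (discrepancy b σ x' y) ≤ k)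
  simp only [Finset.bipartiteAbove, Finset.bipartiteBelow] at hsum
  have hleft : ∀ x' ∈ X,
      (Finset.univ.filter fun σ : Equiv.Perm (Fin n) => weight (discrepancy b σ x' y) ≤ k).card =
      (Finset.univ.filter fun σ : Equiv.Perm (Fin n) => weight (discrepancy b σ x y) ≤ k).card := by
    intro x' hx'
    obtain ⟨π, hπ⟩ := exists_perm_comp_eq (x := x) (y := x') (by simpa [hX] using (by
      simpa [hX] using hx' : weight x' = weight x).symm)
    have key : ∀ σ : Equiv.Perm (Fin n),
        discrepancy b (σ * π) x y = discrepancy b σ x' y ∘ π := by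
      intro σ; funext i; simp [discrepancy, ← hπ]
    refine Finset.card_bij (fun σ _ => σ * π) ?_ ?_ ?_
    · intro σ hσ
      simp only [Finset.mem_filter, Finset.mem_univ, true_and] at hσ ⊢
      rwa [key, weight_comp_perm]
    · intro σ _ τ _ h; exact mul_right_cancel h
    · intro σ hσ
      refine ⟨σ * π⁻¹, ?_, by simp⟩
      simp only [Finset.mem_filter, Finset.mem_univ, true_and] at hσ ⊢
      rwa [← weight_comp_perm _ π, ← key, inv_mul_cancel_right]
  rw [Finset.sum_congr rfl hleft, Finset.sum_const, hX, card_filter_weight_eq, smul_eq_mul] at hsum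
  rw [mul_comm, hsum]
  refine (Finset.sum_le_card_nsmul _ _ (ballCard n k) fun σ _ => ?_).trans
    (by rw [smul_eq_mul, Finset.card_univ, mul_comm])
  refine Finset.card_le_card_of_injOn (fun x' => discrepancy b σ x' y) ?_ ?_
  · intro x' hx'
    simpa using (Finset.mem_filter.1 hx').2
  · intro x' _ x'' _ h
    funext i
    have := congrFun h i
    simpa [discrepancy] using this

/-- Cauchy-Schwarz over the at most `N + 1` fibres of `f`. -/
lemma sq_card_le_mul_card_fiber_product {α : Type*} (T : Finset α) (f : α → ℕ) (N : ℕ)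
    (hf : ∀ x ∈ T, f x ≤ N) :
    T.card ^ 2 ≤ (N + 1) * ((T ×ˢ T).filter fun p => f p.1 = f p.2).card := by
  classical
  have h1 : T.card = ∑ a ∈ Finset.range (N + 1), (T.filter fun x => f x = a).card :=
    Finset.card_eq_sum_card_fiberwise fun x hx => by
      simpa [Nat.lt_succ_iff] using hf x hx
  have h2 : ((T ×ˢ T).filter fun p => f p.1 = f p.2).card =
      ∑ a ∈ Finset.range (N + 1), (T.filter fun x => f x = a).card ^ 2 := by
    rw [Finset.card_eq_sum_card_fiberwise (f := fun p : α × α => f p.1)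
      (t := Finset.range (N + 1))]
    · refine Finset.sum_congr rfl fun a _ => ?_
      rw [sq, ← Finset.card_product]
      congr 1
      ext ⟨u, v⟩
      simp only [Finset.mem_filter, Finset.mem_product]
      constructor
      · rintro ⟨⟨⟨hu, hv⟩, h⟩, rfl⟩; exact ⟨⟨hu, rfl⟩, hv, h.symm⟩
      · rintro ⟨⟨hu, rfl⟩, hv, h⟩; exact ⟨⟨⟨hu, hv⟩, h.symm⟩, rfl⟩
    · intro p hp
      simp only [Finset.coe_filter, Finset.mem_product, Set.mem_ofPred_eq] at hp
      simpa [Nat.lt_succ_iff] using hf _ hp.1.1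
  rw [h2, h1]
  simpa using sq_sum_le_card_mul_sum_sq (s := Finset.range (N + 1))
    (f := fun a => (T.filter fun x => f x = a).card)

/-- The colourings that a fixed involution nearly preserves (or reverses): at most about the square
root of all. -/
lemma sq_card_filter_discrepancy_le {n : ℕ} (b : Bool) (k a : ℕ) (σ : Equiv.Perm (Fin n))
    (hσ : ∀ i, σ (σ i) = i) (hfix : ∀ i j, σ i = i → σ j = j → i = j) :
    (Finset.univ.filter fun x : Fin n → Bool =>
      weight x = a ∧ weight (discrepancy b σ x x) ≤ k).card ^ 2 ≤
      2 * (n + 1) * ballCard n k ^ 2 * n.choose a := by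
  classical
  set T := Finset.univ.filter fun x : Fin n → Bool =>
      weight x = a ∧ weight (discrepancy b σ x x) ≤ k with hT
  -- The points with `i ≤ σ i` are one from each 2-cycle together with the fixed point, if any. Two
  -- members of `T` with equal counts on this half can be glued, one on the half and the other off
  -- it, into a colouring of weight `a` again.
  let f : (Fin n → Bool) → ℕ := fun x => (Finset.univ.filter fun i => x i = true ∧ i ≤ σ i).card
  have hsplit : ∀ x : Fin n → Bool,
      weight x = f x + (Finset.univ.filter fun i => x i = true ∧ ¬ i ≤ σ i).card := by
    intro x
    have := Finset.card_filter_add_card_filter_not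
      (s := Finset.univ.filter fun i => x i = true) (fun i => i ≤ σ i)
    simp only [Finset.filter_filter] at this
    exact this.symm
  have h1 := sq_card_le_mul_card_fiber_product T f n fun x _ =>
    (by have := hsplit x; have := weight_le x; omega)
  set glue : (Fin n → Bool) × (Fin n → Bool) → (Fin n → Bool) := fun p i =>
    if i ≤ σ i then p.1 i else p.2 i with hglue
  have hcard : ((T ×ˢ T).filter fun p => f p.1 = f p.2).card ≤
      ((Finset.univ.filter fun x : Fin n → Bool => weight x = a) ×ˢ
        ((Finset.univ.filter fun w : Fin n → Bool => weight w ≤ k) ×ˢ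
        ((Finset.univ.filter fun w : Fin n → Bool => weight w ≤ k) ×ˢ
          (Finset.univ : Finset Bool)))).card := by
    -- Each colouring is known on one half and the discrepancy carries it across the 2-cycles. The
    -- value of the second colouring at the fixed point is lost in the gluing and costs one extra
    -- bit, whence the factor 2.
    refine Finset.card_le_card_of_injOn (fun p => (glue p, discrepancy b σ p.1 p.1,
      discrepancy b σ p.2 p.2, decide (∃ i, σ i = i ∧ p.2 i = true))) ?_ ?_
    · rintro ⟨x, y⟩ hp
      simp only [hT, Finset.coe_filter, Finset.mem_product, Finset.mem_filter, Finset.mem_univ,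
        true_and, Set.mem_ofPred_eq] at hp
      obtain ⟨⟨⟨hx, hx'⟩, hy, hy'⟩, hxy⟩ := hp
      simp only [Finset.coe_product, Set.mem_prod, Finset.mem_coe, Finset.mem_filter,
        Finset.mem_univ, true_and, and_true]
      refine ⟨?_, hx', hy'⟩
      have e1 : f (glue (x, y)) = f x := by
        simp only [f, hglue]; congr 1; ext i
        simp only [Finset.mem_filter, Finset.mem_univ, true_and]
        constructor
        · rintro ⟨h, h'⟩; exact ⟨by simpa [h'] using h, h'⟩
        · rintro ⟨h, h'⟩; exact ⟨by simpa [h'] using h, h'⟩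
      have e2 : (Finset.univ.filter fun i => glue (x, y) i = true ∧ ¬ i ≤ σ i) =
          (Finset.univ.filter fun i => y i = true ∧ ¬ i ≤ σ i) := by
        ext i
        simp only [Finset.mem_filter, Finset.mem_univ, true_and, hglue]
        constructor
        · rintro ⟨h, h'⟩; exact ⟨by simpa [h'] using h, h'⟩
        · rintro ⟨h, h'⟩; exact ⟨by simpa [h'] using h, h'⟩
      rw [hsplit, e1, e2, hxy, ← hsplit, hy]
    · rintro ⟨x, y⟩ - ⟨x', y'⟩ - h
      simp only [Prod.mk.injEq] at h
      obtain ⟨hg, hx, hy, hd⟩ := h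
      have hxH : ∀ i, i ≤ σ i → x i = x' i := fun i hi => by
        simpa [hglue, hi] using congrFun hg i
      have hyH : ∀ i, ¬ i ≤ σ i → y i = y' i := fun i hi => by
        simpa only [hglue, if_neg hi] using congrFun hg i
      have hx2 : ∀ i, x i = x' i := by
        intro i
        by_cases hi : i ≤ σ i
        · exact hxH i hi
        · have h1 := hxH (σ i) (by rw [hσ]; exact (not_le.1 hi).le)
          have h2 := congrFun hx i
          simp only [discrepancy, h1] at h2
          simpa using h2
      have hy2 : ∀ i, y i = y' i := by
        intro i
        by_cases hi : i ≤ σ i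
        · by_cases hi' : σ i = i
          · have key : ∀ z : Fin n → Bool, (∃ j, σ j = j ∧ z j = true) ↔ z i = true := fun z =>
              ⟨fun ⟨j, hj, hz⟩ => by rwa [hfix i j hi' hj], fun hz => ⟨i, hi', hz⟩⟩
            rw [decide_eq_decide, key, key] at hd
            exact Bool.eq_iff_iff.2 hd
          · have h1 := hyH (σ i) (by
              rw [hσ]; exact not_le.2 (lt_of_le_of_ne hi (Ne.symm hi')))
            have h2 := congrFun hy i
            simp only [discrepancy, h1] at h2
            simpa using h2
        · exact hyH i hi
      rw [Prod.mk.injEq]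
      exact ⟨funext hx2, funext hy2⟩
  simp only [Finset.card_product, card_filter_weight_eq, Finset.card_univ, Fintype.card_bool]
    at hcard
  refine h1.trans ((Nat.mul_le_mul_left _ hcard).trans (le_of_eq ?_))
  simp only [ballCard]
  ring

/-- The same averaging over a weight class, with conjugation in place of right multiplication
because one colouring sits at both ends. The bound for a fixed involution controls a square, so
Cauchy-Schwarz over `I` is needed to sum it. -/
lemma sq_card_involution_discrepancy_mul_choose {n : ℕ} (b : Bool) (k : ℕ) (x : Fin n → Bool)
    (I : Finset (Equiv.Perm (Fin n))) (hconj : ∀ σ ∈ I, ∀ π, π * σ * π⁻¹ ∈ I)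
    (hI : ∀ σ ∈ I, ∀ i, σ (σ i) = i) (hfix : ∀ σ ∈ I, ∀ i j, σ i = i → σ j = j → i = j) :
    (I.filter fun σ => weight (discrepancy b σ x x) ≤ k).card ^ 2 * n.choose (weight x) ≤
      2 * (n + 1) * ballCard n k ^ 2 * I.card ^ 2 := by
  classical
  set X := Finset.univ.filter fun x' : Fin n → Bool => weight x' = weight x with hX
  have hsum := Finset.sum_card_bipartiteAbove_eq_sum_card_bipartiteBelow (s := X)
    (t := I) (fun x' σ => weight (discrepancy b σ x' x') ≤ k)
  simp only [Finset.bipartiteAbove, Finset.bipartiteBelow] at hsum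
  have hleft : ∀ x' ∈ X,
      (I.filter fun σ => weight (discrepancy b σ x' x') ≤ k).card =
      (I.filter fun σ => weight (discrepancy b σ x x) ≤ k).card := by
    intro x' hx'
    have hw : weight x' = weight x := by simpa [hX] using hx'
    obtain ⟨π, hπ⟩ := exists_perm_comp_eq hw
    have key : ∀ σ : Equiv.Perm (Fin n),
        discrepancy b (π * σ * π⁻¹) x x ∘ π = discrepancy b σ x' x' := by
      intro σ; funext i; simp [discrepancy, ← hπ]
    refine Finset.card_bij (fun σ _ => π * σ * π⁻¹) ?_ ?_ ?_
    · intro σ hσ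
      simp only [Finset.mem_filter] at hσ ⊢
      exact ⟨hconj σ hσ.1 π, by rw [← weight_comp_perm _ π, key]; exact hσ.2⟩
    · intro σ _ τ _ h; simpa using h
    · intro σ hσ
      simp only [Finset.mem_filter] at hσ
      refine ⟨π⁻¹ * σ * π, ?_, by group⟩
      simp only [Finset.mem_filter]
      refine ⟨by simpa using hconj σ hσ.1 π⁻¹, ?_⟩
      rw [← key, weight_comp_perm]
      have : π * (π⁻¹ * σ * π) * π⁻¹ = σ := by group
      rw [this]; exact hσ.2
  rw [Finset.sum_congr rfl hleft, Finset.sum_const, hX, card_filter_weight_eq, smul_eq_mul] at hsum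
  set N := (I.filter fun σ => weight (discrepancy b σ x x) ≤ k).card
  set C := n.choose (weight x)
  have hC : 0 < C := Nat.choose_pos (weight_le x)
  have h1 : (C * N) ^ 2 ≤ I.card * (I.card * (2 * (n + 1) * ballCard n k ^ 2 * C)) := by
    rw [hsum]
    refine sq_sum_le_card_mul_sum_sq.trans (Nat.mul_le_mul_left _ ?_)
    rw [← smul_eq_mul (I.card)]
    refine Finset.sum_le_card_nsmul _ _ _ fun σ hσ => ?_
    simpa only [Finset.filter_filter, Nat.cast_id] using
      sq_card_filter_discrepancy_le b k (weight x) σ (hI σ hσ) (hfix σ hσ)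
  refine Nat.le_of_mul_le_mul_left (?_ : C * _ ≤ C * _) hC
  calc C * (N ^ 2 * C) = (C * N) ^ 2 := by ring
    _ ≤ _ := h1
    _ = _ := by ring

/-! ### Binomial coefficients against Hamming balls -/

lemma div_pow_le_choose {n m : ℕ} (h : m ≤ n) : ((n : ℝ) / m) ^ m ≤ n.choose m := by
  induction m generalizing n with
  | zero => simp
  | succ m ih =>
    obtain ⟨n, rfl⟩ : ∃ n', n = n' + 1 := ⟨n - 1, by omega⟩
    have hmn : m ≤ n := by omega
    have h1 : ((n + 1).choose (m + 1) : ℝ) = ((n : ℝ) + 1) / (m + 1) * n.choose m := by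
      have := Nat.add_one_mul_choose_eq n m
      have h2 : ((n : ℝ) + 1) * n.choose m = (n + 1).choose (m + 1) * (m + 1) := by
        exact_mod_cast this
      field_simp
      linarith
    rw [h1, pow_succ', Nat.cast_add_one, Nat.cast_add_one]
    refine mul_le_mul_of_nonneg_left ?_ (by positivity)
    refine le_trans ?_ (ih hmn)
    rcases Nat.eq_zero_or_pos m with rfl | hm
    · simp
    · refine pow_le_pow_left₀ (by positivity) ?_ _
      rw [div_le_div_iff₀ (by positivity) (by positivity)]
      have : (m : ℝ) ≤ n := by exact_mod_cast hmn
      nlinarith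

lemma choose_le_choose_of_two_mul_le {n a m : ℕ} (ham : a ≤ m) (hm : 2 * m ≤ n) :
    n.choose a ≤ n.choose m := by
  induction m, ham using Nat.le_induction with
  | base => exact le_rfl
  | succ m _ ih =>
    exact (ih (by omega)).trans (Nat.choose_le_succ_of_lt_half_left (by omega))

lemma sum_pow_weight (n : ℕ) (t : ℝ) : ∑ w : Fin n → Bool, t ^ weight w = (1 + t) ^ n := by
  have h := Finset.prod_univ_sum (fun _ : Fin n => (Finset.univ : Finset Bool))
    (fun _ c => if c = true then t else 1)
  simp only [Fintype.sum_bool, if_true, Bool.false_eq_true, if_false, Finset.prod_const,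
    Finset.card_univ, Fintype.card_fin, Fintype.piFinset_univ] at h
  rw [add_comm, h]
  refine Finset.sum_congr rfl fun w _ => ?_
  rw [Finset.prod_ite, Finset.prod_const_one, mul_one, Finset.prod_const, weight]

/-- Chernoff's method: for `t ≤ 1`, every colouring in the ball contributes at least `t ^ k` to the
generating function of the weight. -/
lemma ballCard_mul_pow_le (n k : ℕ) {t : ℝ} (h0 : 0 < t) (h1 : t ≤ 1) :
    (ballCard n k : ℝ) * t ^ k ≤ (1 + t) ^ n := by
  rw [← sum_pow_weight, ballCard, ← nsmul_eq_mul, ← Finset.sum_const]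
  refine (Finset.sum_le_sum fun w hw => ?_).trans
    (Finset.sum_le_sum_of_subset_of_nonneg (Finset.subset_univ _) fun w _ _ => by positivity)
  exact pow_le_pow_of_le_one h0.le h1 (Finset.mem_filter.1 hw).2

/-- Put `a = n / m ≥ 2`. The Chernoff bound at `t = 1 / (q a)` gives `ballCard n k ^ q ≤ (3 q a) ^
m`, whereas `n.choose m ≥ a ^ m`. So `(3 q a) ^ K ≤ a ^ q` suffices; for `q ≥ K` this reduces to `a
= 2`, that is `(6 q) ^ K ≤ 2 ^ q`, which holds for large `q`. -/
lemma exists_ballCard_pow_le_choose (K : ℕ) : ∃ q : ℕ, 0 < q ∧ ∀ n m k : ℕ, 0 < m → 2 * m ≤ n →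
    q * k ≤ m → ballCard n k ^ K ≤ n.choose m := by
  have hlim := tendsto_pow_const_div_const_pow_of_one_lt K (one_lt_two (α := ℝ))
  have hev : ∀ᶠ q : ℕ in Filter.atTop, (q : ℝ) ^ K / 2 ^ q ≤ 1 / 6 ^ K :=
    hlim.eventually (Iic_mem_nhds (by positivity))
  obtain ⟨q, hq, hqK⟩ := (hev.and (Filter.eventually_ge_atTop (K + 1))).exists
  have hq0 : 0 < q := by omega
  refine ⟨q, hq0, fun n m k hm hmn hk => ?_⟩
  have hm' : (0 : ℝ) < m := by exact_mod_cast hm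
  have hq' : (1 : ℝ) ≤ q := by exact_mod_cast hq0
  have hn' : (0 : ℝ) < n := by exact_mod_cast (by omega : 0 < n)
  set a : ℝ := n / m with ha
  have ha2 : 2 ≤ a := by
    rw [ha, le_div_iff₀ hm']; exact_mod_cast hmn
  have hy : 1 ≤ q * a := by nlinarith
  have hball : (ballCard n k : ℝ) ^ q ≤ (3 * (q * a)) ^ m := by
    have h1 := ballCard_mul_pow_le n k (t := (q * a)⁻¹) (by positivity) (inv_le_one_of_one_le₀ hy)
    have h2 : (1 + (q * a)⁻¹) ^ n ≤ Real.exp ((q * a)⁻¹ * n) := by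
      rw [mul_comm _ (n : ℝ), Real.exp_nat_mul]
      refine pow_le_pow_left₀ (by positivity) ?_ _
      rw [add_comm]; exact Real.add_one_le_exp _
    have h3 : (ballCard n k : ℝ) ≤ (q * a) ^ k * Real.exp ((q * a)⁻¹ * n) := by
      have := h1.trans h2
      rw [inv_pow, ← div_eq_mul_inv, div_le_iff₀ (by positivity)] at this
      linarith
    have h4 : (q * a)⁻¹ * n * q = m := by
      rw [ha]; field_simp
    calc (ballCard n k : ℝ) ^ q ≤ ((q * a) ^ k * Real.exp ((q * a)⁻¹ * n)) ^ q :=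
          pow_le_pow_left₀ (by positivity) h3 _
      _ = (q * a) ^ (q * k) * Real.exp 1 ^ m := by
          rw [mul_pow, ← pow_mul, mul_comm k q, ← Real.exp_nat_mul, ← Real.exp_nat_mul,
            mul_comm (q : ℝ) (_ * (n : ℝ)), h4, mul_one]
      _ ≤ (q * a) ^ m * 3 ^ m := by
          gcongr
          exact (Real.exp_one_lt_d9.trans (by norm_num)).le
      _ = _ := by rw [← mul_pow]; ring
  have hpow : (3 * (q * a)) ^ K ≤ a ^ q := by
    have h1 : (6 * (q : ℝ)) ^ K ≤ 2 ^ q := by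
      rw [mul_pow]
      rw [div_le_div_iff₀ (by positivity) (by positivity)] at hq
      linarith
    have h2 : (3 * (q : ℝ)) ^ K ≤ 2 ^ (q - K) := by
      have e1 : (6 * (q : ℝ)) ^ K = 2 ^ K * (3 * q) ^ K := by rw [← mul_pow]; ring
      have e2 : (2 : ℝ) ^ q = 2 ^ K * 2 ^ (q - K) := by rw [← pow_add]; congr 1; omega
      rw [e1, e2] at h1
      exact le_of_mul_le_mul_left h1 (by positivity)
    calc (3 * (q * a)) ^ K = (3 * (q : ℝ)) ^ K * a ^ K := by rw [← mul_pow]; ring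
      _ ≤ a ^ (q - K) * a ^ K := by
          refine mul_le_mul_of_nonneg_right (h2.trans ?_) (by positivity)
          exact pow_le_pow_left₀ (by norm_num) ha2 _
      _ = a ^ q := by rw [← pow_add]; congr 1; omega
  have hfin : ((ballCard n k : ℝ) ^ K) ^ q ≤ (n.choose m : ℝ) ^ q := by
    calc ((ballCard n k : ℝ) ^ K) ^ q = ((ballCard n k : ℝ) ^ q) ^ K := by
          rw [← pow_mul, ← pow_mul, mul_comm]
      _ ≤ ((3 * (q * a)) ^ m) ^ K := pow_le_pow_left₀ (by positivity) hball _
      _ = ((3 * (q * a)) ^ K) ^ m := by rw [← pow_mul, ← pow_mul, mul_comm m]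
      _ ≤ (a ^ q) ^ m := pow_le_pow_left₀ (by positivity) hpow _
      _ = (a ^ m) ^ q := by rw [← pow_mul, ← pow_mul, mul_comm]
      _ ≤ _ := pow_le_pow_left₀ (by positivity) (div_pow_le_choose (by omega)) _
  exact_mod_cast le_of_pow_le_pow_left₀ hq0.ne' (by positivity) hfin

lemma exists_pow_le_choose (J : ℕ) : ∃ m₀ n₀ : ℕ, 0 < m₀ ∧ ∀ n m : ℕ, n₀ ≤ n → m₀ ≤ m →
    2 * m ≤ n → n ^ J ≤ n.choose m := by
  refine ⟨J + 1, (J + 1) ^ (J + 1), by omega, fun n m hn hm hmn => ?_⟩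
  refine le_trans ?_ (choose_le_choose_of_two_mul_le hm hmn)
  have h := div_pow_le_choose (n := n) (m := J + 1) (by omega)
  rw [div_pow, div_le_iff₀ (by positivity)] at h
  have h' : n ^ (J + 1) ≤ n.choose (J + 1) * (J + 1) ^ (J + 1) := by exact_mod_cast h
  refine Nat.le_of_mul_le_mul_right (?_ : _ * (J + 1) ^ (J + 1) ≤ _) (by positivity)
  exact le_trans (by rw [pow_succ n]; exact Nat.mul_le_mul_left _ hn) h'

/-- After squaring, one copy of the binomial pays for the ball and the other for the powers of `n`.
-/
lemma exists_poly_mul_ballCard_pow_le_choose (K J : ℕ) : ∃ q m₀ n₀ : ℕ, 0 < q ∧ 0 < m₀ ∧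
    ∀ n m k : ℕ, n₀ ≤ n → m₀ ≤ m → 2 * m ≤ n → q * k ≤ m →
      (2 * (n + 1)) ^ K * ballCard n k ^ (2 * K) * n ^ J ≤ n.choose m := by
  obtain ⟨q, hq, hball⟩ := exists_ballCard_pow_le_choose (4 * K)
  obtain ⟨m₀, n₀, hm₀, hpow⟩ := exists_pow_le_choose (2 * (3 * K + J))
  refine ⟨q, m₀, n₀, hq, hm₀, fun n m k hn hm hmn hk => ?_⟩
  have h1 := hball n m k (by omega) hmn hk
  have h2 := hpow n m hn hm hmn
  have hn2 : 2 ≤ n := by omega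
  have h3 : (2 * (n + 1)) ^ K ≤ n ^ (3 * K) := by
    rw [pow_mul]
    refine Nat.pow_le_pow_left ?_ _
    nlinarith [Nat.mul_le_mul hn2 hn2]
  refine (Nat.pow_le_pow_iff_left two_ne_zero).1 ?_
  calc ((2 * (n + 1)) ^ K * ballCard n k ^ (2 * K) * n ^ J) ^ 2
      ≤ (n ^ (3 * K) * ballCard n k ^ (2 * K) * n ^ J) ^ 2 := by gcongr
    _ = n ^ (2 * (3 * K + J)) * ballCard n k ^ (4 * K) := by ring
    _ ≤ n.choose m * n.choose m := Nat.mul_le_mul h2 h1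
    _ = _ := (sq _).symm

/-! ### The probability that a fixed colouring is nearly preserved -/

namespace MultiGraph

/-- The permutations that the random model allows on a half-loop. -/
noncomputable def halfLoopPerms (n : ℕ) : Finset (Equiv.Perm (Fin n)) :=
  (Set.toFinite {σ : Equiv.Perm (Fin n) | (∀ i, σ (σ i) = i) ∧
    (Even n → ∀ i, σ i ≠ i) ∧ (Odd n → ∃! i, σ i = i)}).toFinset

lemma mem_halfLoopPerms {n : ℕ} {σ : Equiv.Perm (Fin n)} : σ ∈ halfLoopPerms n ↔
    (∀ i, σ (σ i) = i) ∧ (Even n → ∀ i, σ i ≠ i) ∧ (Odd n → ∃! i, σ i = i) := by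
  simp [halfLoopPerms]

lemma conj_mem_halfLoopPerms {n : ℕ} {σ : Equiv.Perm (Fin n)} (h : σ ∈ halfLoopPerms n)
    (π : Equiv.Perm (Fin n)) : π * σ * π⁻¹ ∈ halfLoopPerms n := by
  rw [mem_halfLoopPerms] at h ⊢
  refine ⟨fun i => by simp [h.1], fun hn i hi => h.2.1 hn (π⁻¹ i) ?_, fun hn => ?_⟩
  · rw [Equiv.Perm.eq_inv_iff_eq]; exact hi
  · obtain ⟨i, hi, hu⟩ := h.2.2 hn
    refine ⟨π i, by simpa using hi, fun j hj => ?_⟩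
    have := hu (π⁻¹ j) (show σ (π⁻¹ j) = π⁻¹ j by rw [Equiv.Perm.eq_inv_iff_eq]; exact hj)
    simp [← this]

lemma fixed_unique_of_mem_halfLoopPerms {n : ℕ} {σ : Equiv.Perm (Fin n)}
    (h : σ ∈ halfLoopPerms n) (i j : Fin n) (hi : σ i = i) (hj : σ j = j) : i = j := by
  rw [mem_halfLoopPerms] at h
  rcases Nat.even_or_odd n with hn | hn
  · exact absurd hi (h.2.1 hn i)
  · exact (h.2.2 hn).unique hi hj

variable {V : Type u} {E : Type v}

open Classical in
/-- The permutations that the random model allows on the edge `e`. -/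
noncomputable def edgePerms (B : MultiGraph V E) (n : ℕ) (e : E) : Finset (Equiv.Perm (Fin n)) :=
  if B.inv e = e then halfLoopPerms n else Finset.univ

lemma mem_edgePerms_of_admissible {B : MultiGraph V E} {n : ℕ} {σ : B.PermAssignment n}
    (h : σ ∈ B.admissible n) (e : E) : σ.1 e ∈ B.edgePerms n e := by
  unfold edgePerms
  split_ifs with he
  · refine mem_halfLoopPerms.2 ⟨fun i => ?_, h e he⟩
    have := σ.2 e
    rw [he] at this
    nth_rewrite 1 [this]
    simp
  · exact Finset.mem_univ _

/-- The order on `E` only serves to pick the representative `e ≤ B.inv e` of each pair; an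
assignment is determined by its values on representatives. -/
lemma card_admissible_filter_le [Fintype E] [LinearOrder E] (B : MultiGraph V E) (n : ℕ)
    (A : E → Equiv.Perm (Fin n) → Prop) [∀ e, DecidablePred (A e)] :
    (B.admissible n ∩ {σ | ∀ e, A e (σ.1 e)}).ncard ≤
      ∏ e, if e ≤ B.inv e then ((B.edgePerms n e).filter (A e)).card else 1 := by
  have h1 : (∏ e, if e ≤ B.inv e then ((B.edgePerms n e).filter (A e)).card else 1) =
      (Fintype.piFinset fun e =>
        if e ≤ B.inv e then (B.edgePerms n e).filter (A e) else {1}).card := by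
    rw [Fintype.card_piFinset]
    exact Finset.prod_congr rfl fun e _ => by split_ifs <;> simp
  rw [h1, ← Set.ncard_coe_finset]
  refine Set.ncard_le_ncard_of_injOn (fun σ e => if e ≤ B.inv e then σ.1 e else 1) ?_ ?_
    (Set.toFinite _)
  · intro σ hσ
    rw [Finset.mem_coe, Fintype.mem_piFinset]
    intro e
    by_cases he : e ≤ B.inv e
    · simp only [he, if_true, Finset.mem_filter]
      exact ⟨mem_edgePerms_of_admissible hσ.1 e, hσ.2 e⟩
    · simp [he]
  · intro σ _ τ _ h
    refine Subtype.ext (funext fun e => ?_)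
    by_cases he : e ≤ B.inv e
    · simpa [he] using congrFun h e
    · have h2 := congrFun h (B.inv e)
      have he' : B.inv e ≤ B.inv (B.inv e) := by rw [B.inv_inv]; exact (not_le.1 he).le
      simp only [he', if_true] at h2
      rw [σ.2, τ.2] at h2
      exact inv_injective h2

/-- Conversely, free choices on representatives extend by inversion. On a half-loop the extension is
consistent because the chosen permutation is an involution. -/
lemma prod_card_edgePerms_le [Fintype E] [LinearOrder E] (B : MultiGraph V E) (n : ℕ) :
    (∏ e, if e ≤ B.inv e then (B.edgePerms n e).card else 1) ≤ (B.admissible n).ncard := by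
  have h1 : (∏ e, if e ≤ B.inv e then (B.edgePerms n e).card else 1) =
      (Fintype.piFinset fun e =>
        if e ≤ B.inv e then B.edgePerms n e else {1}).card := by
    rw [Fintype.card_piFinset]
    exact Finset.prod_congr rfl fun e _ => by split_ifs <;> simp
  rw [h1, ← Set.ncard_coe_finset]
  have hmem : ∀ τ ∈ (Fintype.piFinset fun e =>
      if e ≤ B.inv e then B.edgePerms n e else {1}), ∀ e, e ≤ B.inv e → τ e ∈ B.edgePerms n e := by
    intro τ hτ e he
    have := Fintype.mem_piFinset.1 hτ e
    rwa [if_pos he] at this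
  refine (Set.ncard_le_ncard (t := (fun (σ : B.PermAssignment n) e =>
    if e ≤ B.inv e then σ.1 e else 1) '' B.admissible n) ?_ (Set.toFinite _)).trans
    (Set.ncard_image_le (Set.toFinite _))
  intro τ hτ
  rw [Finset.mem_coe] at hτ
  have hhalf : ∀ e, B.inv e = e → τ e ∈ halfLoopPerms n := by
    intro e he
    have := hmem τ hτ e he.ge
    rwa [edgePerms, if_pos he] at this
  refine ⟨⟨fun e => if e ≤ B.inv e then τ e else (τ (B.inv e))⁻¹, fun e => ?_⟩, ?_, ?_⟩
  · rcases lt_trichotomy e (B.inv e) with he | he | he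
    · simp [B.inv_inv, he.le, not_le.2 he]
    · have h := (mem_halfLoopPerms.1 (hhalf e he.symm)).1
      simp only [← he, le_refl, if_true]
      exact eq_inv_of_mul_eq_one_left (Equiv.ext h)
    · simp [B.inv_inv, he.le, not_le.2 he]
  · intro e he
    have he' : B.inv e = e := he
    have h := (mem_halfLoopPerms.1 (hhalf e he')).2
    simpa [he'] using h
  · funext e
    have := Fintype.mem_piFinset.1 hτ e
    by_cases he : e ≤ B.inv e
    · simp [he]
    · simp only [he, if_false, Finset.mem_singleton] at this ⊢
      exact this.symm

lemma edgePerms_nonempty (B : MultiGraph V E) (n : ℕ) (e : E) : (B.edgePerms n e).Nonempty := by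
  obtain ⟨σ, hσ⟩ := B.admissible_nonempty n
  exact ⟨σ.1 e, mem_edgePerms_of_admissible hσ e⟩

lemma broderShamir_real_apply [Fintype E] (B : MultiGraph V E) (n : ℕ) (S : Set (B.PermAssignment n)) :
    (B.broderShamir n).real S = ((B.admissible n ∩ S).ncard : ℝ) / (B.admissible n).ncard := by
  have hcount : ∀ T : Set (B.PermAssignment n), (Measure.count T).toReal = (T.ncard : ℝ) := by
    intro T
    rw [Measure.count_apply (Set.toFinite T).measurableSet, ← (Set.toFinite T).cast_ncard_eq]
    rfl
  rw [measureReal_def, broderShamir, uniformOn,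
    cond_apply (Set.toFinite _).measurableSet, ENNReal.toReal_mul, ENNReal.toReal_inv,
    hcount, hcount, div_eq_inv_mul]

lemma card_perm_discrepancy_mul_choose_right {n : ℕ} (b : Bool) (k : ℕ) (x y : Fin n → Bool) :
    (Finset.univ.filter fun σ : Equiv.Perm (Fin n) => weight (discrepancy b σ x y) ≤ k).card *
      n.choose (weight y) ≤ ballCard n k * Fintype.card (Equiv.Perm (Fin n)) := by
  refine le_trans (Nat.mul_le_mul_right _ (le_of_eq ?_))
    (card_perm_discrepancy_mul_choose b k y x)
  have key : ∀ σ : Equiv.Perm (Fin n),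
      weight (discrepancy b σ⁻¹ y x) = weight (discrepancy b σ x y) := by
    intro σ
    rw [← weight_comp_perm _ σ]
    congr 1; funext i
    simp [discrepancy, Bool.xor_comm]
  refine Finset.card_bij (fun σ _ => σ⁻¹) ?_ ?_ ?_
  · intro σ hσ; simpa [key] using hσ
  · intro σ _ τ _ h; exact inv_injective h
  · intro σ hσ
    refine ⟨σ⁻¹, ?_, _root_.inv_inv σ⟩
    rw [Finset.mem_filter] at hσ ⊢
    exact ⟨Finset.mem_univ _, by rw [← key, _root_.inv_inv]; exact hσ.2⟩

/-- The bound for the square of the contribution of one edge to the probability that a colouring is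
nearly preserved. -/
noncomputable def edgeBound (B : MultiGraph V E) {n : ℕ} (k : ℕ) (x : V → Fin n → Bool) (e : E) :
    ℝ :=
  2 * (n + 1) * (ballCard n k : ℝ) ^ 2 / n.choose (weight (x (B.tail e)))

lemma sq_edge_ratio_le_of_inv_eq (B : MultiGraph V E) {n : ℕ} (b : Bool) (k : ℕ)
    (x : V → Fin n → Bool) {e : E} (he : B.inv e = e) :
    ((((B.edgePerms n e).filter fun σ =>
      weight (discrepancy b σ (x (B.tail e)) (x (B.head e))) ≤ k).card : ℝ) /
      (B.edgePerms n e).card) ^ 2 ≤ B.edgeBound k x e := by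
  have hpos : (0 : ℝ) < (B.edgePerms n e).card := by
    exact_mod_cast Finset.card_pos.2 (B.edgePerms_nonempty n e)
  have hC : (0 : ℝ) < n.choose (weight (x (B.tail e))) := by
    exact_mod_cast Nat.choose_pos (weight_le _)
  have hh : B.head e = B.tail e := by rw [← B.tail_inv, he]
  have h := sq_card_involution_discrepancy_mul_choose b k (x (B.tail e)) (halfLoopPerms n)
    (fun σ hσ π => conj_mem_halfLoopPerms hσ π) (fun σ hσ => (mem_halfLoopPerms.1 hσ).1)
    (fun σ hσ => fixed_unique_of_mem_halfLoopPerms hσ)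
  rw [hh, edgeBound, div_pow, div_le_div_iff₀ (by positivity) hC]
  rw [edgePerms, if_pos he]
  exact_mod_cast h

/-- The bounds through the tail and through the head are multiplied. A factor `2 * (n + 1) *
ballCard n k` is given away in each, so that half-loops and other edges have bounds of one form. -/
lemma sq_edge_ratio_le_of_inv_ne (B : MultiGraph V E) {n : ℕ} (b : Bool) (k : ℕ)
    (x : V → Fin n → Bool) {e : E} (he : B.inv e ≠ e) :
    ((((B.edgePerms n e).filter fun σ =>
      weight (discrepancy b σ (x (B.tail e)) (x (B.head e))) ≤ k).card : ℝ) /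
      (B.edgePerms n e).card) ^ 2 ≤ B.edgeBound k x e * B.edgeBound k x (B.inv e) := by
  have hpos : (0 : ℝ) < (B.edgePerms n e).card := by
    exact_mod_cast Finset.card_pos.2 (B.edgePerms_nonempty n e)
  have hC : (0 : ℝ) < n.choose (weight (x (B.tail e))) := by
    exact_mod_cast Nat.choose_pos (weight_le _)
  have hD : (0 : ℝ) < n.choose (weight (x (B.head e))) := by
    exact_mod_cast Nat.choose_pos (weight_le _)
  have hβ : (1 : ℝ) ≤ ballCard n k := by exact_mod_cast one_le_ballCard n k
  have h1 := card_perm_discrepancy_mul_choose b k (x (B.tail e)) (x (B.head e))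
  have h2 := card_perm_discrepancy_mul_choose_right b k (x (B.tail e)) (x (B.head e))
  rw [← Finset.card_univ] at h1 h2
  unfold edgeBound
  rw [B.tail_inv]
  simp only [edgePerms, if_neg he] at hpos ⊢
  set N := (Finset.univ.filter fun σ : Equiv.Perm (Fin n) =>
    weight (discrepancy b σ (x (B.tail e)) (x (B.head e))) ≤ k).card
  set M := (Finset.univ : Finset (Equiv.Perm (Fin n))).card
  have h1' : (N : ℝ) / M ≤ ballCard n k / n.choose (weight (x (B.tail e))) := by
    rw [div_le_div_iff₀ hpos hC]; exact_mod_cast h1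
  have h2' : (N : ℝ) / M ≤ ballCard n k / n.choose (weight (x (B.head e))) := by
    rw [div_le_div_iff₀ hpos hD]; exact_mod_cast h2
  have h3 : (ballCard n k : ℝ) ≤ 2 * (n + 1) * (ballCard n k : ℝ) ^ 2 := by
    have : (0 : ℝ) ≤ n := Nat.cast_nonneg n
    nlinarith
  rw [sq]
  refine mul_le_mul (h1'.trans ?_) (h2'.trans ?_) (by positivity) (by positivity)
  · exact div_le_div_of_nonneg_right h3 hC.le
  · exact div_le_div_of_nonneg_right h3 hD.le

lemma prod_orbit_eq [Fintype E] [LinearOrder E] (B : MultiGraph V E) (g : E → ℝ) :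
    (∏ e, if e ≤ B.inv e then (if B.inv e = e then g e else g e * g (B.inv e)) else 1) =
      ∏ e, g e := by
  let ι : Equiv.Perm E := ⟨B.inv, B.inv, B.inv_inv, B.inv_inv⟩
  have h1 : (∏ e, if e < B.inv e then g (B.inv e) else 1) =
      ∏ e, if B.inv e < e then g e else 1 := by
    rw [← Equiv.prod_comp ι]
    refine Finset.prod_congr rfl fun e _ => ?_
    simp only [ι, Equiv.coe_fn_mk, B.inv_inv]
  have h2 : ∀ e, (if e ≤ B.inv e then (if B.inv e = e then g e else g e * g (B.inv e)) else 1) =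
      (if e ≤ B.inv e then g e else 1) * (if e < B.inv e then g (B.inv e) else 1) := by
    intro e
    rcases lt_trichotomy e (B.inv e) with he | he | he
    · simp [he, he.le, he.ne']
    · simp [← he]
    · simp [not_le.2 he, he.le]
  rw [Finset.prod_congr rfl fun e _ => h2 e, Finset.prod_mul_distrib, h1,
    ← Finset.prod_mul_distrib]
  refine Finset.prod_congr rfl fun e _ => ?_
  by_cases he : e ≤ B.inv e
  · simp [he, not_lt.2 he]
  · simp [he, not_le.1 he]

lemma sq_broderShamir_discrepancy_le [Fintype E] (B : MultiGraph V E) {n : ℕ} (b : Bool) (k : ℕ)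
    (x : V → Fin n → Bool) :
    (B.broderShamir n).real {σ | ∀ e,
      weight (discrepancy b (σ.1 e) (x (B.tail e)) (x (B.head e))) ≤ k} ^ 2 ≤
      ∏ e, B.edgeBound k x e := by
  let _ : LinearOrder E := LinearOrder.lift' (Fintype.equivFin E) (Equiv.injective _)
  set A : E → Equiv.Perm (Fin n) → Prop := fun e σ =>
    weight (discrepancy b σ (x (B.tail e)) (x (B.head e))) ≤ k
  have hnum := B.card_admissible_filter_le n A
  have hden := B.prod_card_edgePerms_le n
  have hpos : ∀ e, 0 < (B.edgePerms n e).card :=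
    fun e => Finset.card_pos.2 (B.edgePerms_nonempty n e)
  have hposP : 0 < ∏ e, if e ≤ B.inv e then (B.edgePerms n e).card else 1 :=
    Finset.prod_pos fun e _ => by split_ifs <;> simp [hpos]
  have h1 : (B.broderShamir n).real {σ | ∀ e, A e (σ.1 e)} ≤
      ∏ e, if e ≤ B.inv e then
        (((B.edgePerms n e).filter (A e)).card : ℝ) / (B.edgePerms n e).card else 1 := by
    rw [broderShamir_real_apply]
    have e1 : (∏ e, if e ≤ B.inv e then
        (((B.edgePerms n e).filter (A e)).card : ℝ) / (B.edgePerms n e).card else 1) =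
        ((∏ e, if e ≤ B.inv e then ((B.edgePerms n e).filter (A e)).card else 1 : ℕ) : ℝ) /
        ((∏ e, if e ≤ B.inv e then (B.edgePerms n e).card else 1 : ℕ) : ℝ) := by
      rw [Nat.cast_prod, Nat.cast_prod, ← Finset.prod_div_distrib]
      refine Finset.prod_congr rfl fun e _ => ?_
      split_ifs <;> simp
    rw [e1]
    exact div_le_div₀ (Nat.cast_nonneg _) (by exact_mod_cast hnum) (by exact_mod_cast hposP)
      (by exact_mod_cast hden)
  refine (pow_le_pow_left₀ measureReal_nonneg h1 2).trans ?_
  rw [← Finset.prod_pow, ← B.prod_orbit_eq (B.edgeBound k x)]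
  refine Finset.prod_le_prod (fun e _ => by positivity) fun e _ => ?_
  split_ifs with h2 h3
  · exact B.sq_edge_ratio_le_of_inv_eq b k x h3
  · exact B.sq_edge_ratio_le_of_inv_ne b k x h3
  · simp

end MultiGraph

/-! ### The union bound over colourings -/

lemma sum_inv_choose_weight (n : ℕ) :
    ∑ w : Fin n → Bool, ((n.choose (weight w) : ℝ))⁻¹ = n + 1 := by
  rw [← Finset.sum_fiberwise_of_maps_to (t := Finset.range (n + 1)) (g := weight)
    (fun w _ => Finset.mem_range.2 (Nat.lt_succ_of_le (weight_le w)))]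
  have h : ∀ a ∈ Finset.range (n + 1), ∑ w : Fin n → Bool with weight w = a,
      ((n.choose (weight w) : ℝ))⁻¹ = 1 := by
    intro a ha
    have hC : (0 : ℝ) < n.choose a := by
      exact_mod_cast Nat.choose_pos (Nat.lt_succ_iff.1 (Finset.mem_range.1 ha))
    rw [Finset.sum_congr rfl fun w hw => by rw [(Finset.mem_filter.1 hw).2], Finset.sum_const,
      card_filter_weight_eq, nsmul_eq_mul, mul_inv_cancel₀ hC.ne']
  rw [Finset.sum_congr rfl h]
  simp

/-- There are exponentially many colourings, but each weight class at a vertex has total mass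
exactly 1, so the total is polynomial in `n`. -/
lemma sum_prod_inv_choose_weight (V : Type*) [Fintype V] [DecidableEq V] (n : ℕ) :
    ∑ x : V → Fin n → Bool, ∏ v, ((n.choose (weight (x v)) : ℝ))⁻¹ = (n + 1) ^ Fintype.card V := by
  have h := Finset.prod_univ_sum (fun _ : V => (Finset.univ : Finset (Fin n → Bool)))
    (fun _ w => ((n.choose (weight w) : ℝ))⁻¹)
  rw [Fintype.piFinset_univ] at h
  rw [← h]
  simp [sum_inv_choose_weight, Finset.prod_const]

namespace MultiGraph

variable {V : Type u} {E : Type v} [Fintype E]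

lemma card_filter_tail_eq [DecidableEq V] (B : MultiGraph V E) {d : ℕ} (hreg : B.IsRegular d) (v : V) :
    (Finset.univ.filter fun e => B.tail e = v).card = d := by
  classical
  rw [← hreg v, degree, Nat.card_eq_fintype_card, Fintype.card_subtype]

variable [Fintype V] [DecidableEq V]

lemma prod_edgeBound (B : MultiGraph V E) {d : ℕ} (hreg : B.IsRegular d) {n : ℕ} (k : ℕ)
    (x : V → Fin n → Bool) :
    ∏ e, B.edgeBound k x e = (2 * (n + 1) * (ballCard n k : ℝ) ^ 2) ^ Fintype.card E /
      ∏ v, (n.choose (weight (x v)) : ℝ) ^ d := by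
  unfold edgeBound
  rw [Finset.prod_div_distrib, Finset.prod_const, Finset.card_univ]
  congr 1
  rw [← Finset.prod_fiberwise (s := Finset.univ) (g := B.tail)]
  refine Finset.prod_congr rfl fun v _ => ?_
  rw [Finset.prod_congr rfl fun e he => by rw [(Finset.mem_filter.1 he).2], Finset.prod_const,
    B.card_filter_tail_eq hreg]

/-- This is where `3 ≤ d` enters. By `hv`, the numerator of the squared bound times `n ^ (2 * J)` is
at most one binomial, hence at most the product `P` of all of them; dividing by `P ^ d` still leaves
`P ^ (-2)`. -/
lemma broderShamir_discrepancy_le (B : MultiGraph V E) {d : ℕ} (hd : 3 ≤ d)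
    (hreg : B.IsRegular d) {n : ℕ} (hn : 0 < n) (b : Bool) (k J : ℕ) (x : V → Fin n → Bool) (v : V)
    (hv : (2 * (n + 1)) ^ Fintype.card E * ballCard n k ^ (2 * Fintype.card E) * n ^ (2 * J) ≤
      n.choose (weight (x v))) :
    (B.broderShamir n).real {σ | ∀ e,
      weight (discrepancy b (σ.1 e) (x (B.tail e)) (x (B.head e))) ≤ k} ≤
      ((n : ℝ) ^ J)⁻¹ * ∏ v, ((n.choose (weight (x v)) : ℝ))⁻¹ := by
  have hC : ∀ v, (1 : ℝ) ≤ n.choose (weight (x v)) := fun v => by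
    exact_mod_cast Nat.choose_pos (weight_le (x v))
  have hCpos : ∀ v, (0 : ℝ) < n.choose (weight (x v)) := fun v => one_pos.trans_le (hC v)
  have hn' : (0 : ℝ) < n := by exact_mod_cast hn
  set P : ℝ := ∏ v, (n.choose (weight (x v)) : ℝ) with hP
  have hPpos : 0 < P := Finset.prod_pos fun v _ => hCpos v
  have hvP : (n.choose (weight (x v)) : ℝ) ≤ P := by
    rw [hP, ← Finset.mul_prod_erase _ _ (Finset.mem_univ v)]
    exact le_mul_of_one_le_right (hCpos v).le (Finset.one_le_prod fun v _ => hC v)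
  rw [Finset.prod_inv_distrib, ← mul_inv]
  refine le_of_sq_le_sq ?_ (by positivity)
  refine (B.sq_broderShamir_discrepancy_le b k x).trans ?_
  have hv' : (2 * ((n : ℝ) + 1)) ^ Fintype.card E * (ballCard n k : ℝ) ^ (2 * Fintype.card E) *
      (n : ℝ) ^ (2 * J) ≤ n.choose (weight (x v)) := by exact_mod_cast hv
  rw [B.prod_edgeBound hreg, Finset.prod_pow, ← hP, inv_pow, ← one_div,
    div_le_div_iff₀ (by positivity) (by positivity), one_mul]
  calc (2 * ((n : ℝ) + 1) * (ballCard n k : ℝ) ^ 2) ^ Fintype.card E * ((n : ℝ) ^ J * P) ^ 2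
      = ((2 * ((n : ℝ) + 1)) ^ Fintype.card E * (ballCard n k : ℝ) ^ (2 * Fintype.card E) *
        (n : ℝ) ^ (2 * J)) * P ^ 2 := by rw [mul_pow (2 * ((n : ℝ) + 1)), ← pow_mul]; ring
    _ ≤ P * P ^ 2 := by gcongr; exact hv'.trans hvP
    _ = P ^ 3 := by ring
    _ ≤ P ^ d := pow_le_pow_right₀ ((hC v).trans hvP) hd

/-- With high probability no colouring that takes both values often enough at some vertex of the
base is nearly preserved (`b = false`) or nearly reversed (`b = true`) along all edges. -/
lemma exists_broderShamir_nearly_preserved_le (B : MultiGraph V E) {d : ℕ} (hd : 3 ≤ d)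
    (hreg : B.IsRegular d) (j : ℕ) :
    ∃ q m₀ n₀ : ℕ, 0 < q ∧ 0 < m₀ ∧ ∀ (b : Bool) (n : ℕ), n₀ ≤ n →
      (B.broderShamir n).real {σ | ∃ (x : V → Fin n → Bool) (v : V),
        m₀ ≤ min (weight (x v)) (n - weight (x v)) ∧
        ∀ e, q * weight (discrepancy b (σ.1 e) (x (B.tail e)) (x (B.head e))) ≤
          min (weight (x v)) (n - weight (x v))} ≤ 1 / (n : ℝ) ^ j := by
  -- The term `3 * Fintype.card V` pays for the union bound: the choice of `v` costs at most `n ^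
  -- |V|`, and the sum over `x` is `(n + 1) ^ |V| ≤ n ^ (2 |V|)` for `n ≥ 2`. The exponent is
  -- doubled because probabilities are bounded through their squares.
  obtain ⟨q, m₀, n₀, hq, hm₀, hmain⟩ := exists_poly_mul_ballCard_pow_le_choose (Fintype.card E)
    (2 * (j + 3 * Fintype.card V))
  refine ⟨q, m₀, max n₀ 2, hq, hm₀, fun b n hn => ?_⟩
  have hn2 : 2 ≤ n := (le_max_right _ _).trans hn
  have hn2' : (2 : ℝ) ≤ n := by exact_mod_cast hn2
  set m : (V → Fin n → Bool) × V → ℕ := fun p => min (weight (p.1 p.2)) (n - weight (p.1 p.2))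
  set ev : (V → Fin n → Bool) × V → Set (B.PermAssignment n) := fun p => {σ | m₀ ≤ m p ∧
    ∀ e, q * weight (discrepancy b (σ.1 e) (p.1 (B.tail e)) (p.1 (B.head e))) ≤ m p} with hev
  have hsub : {σ : B.PermAssignment n | ∃ (x : V → Fin n → Bool) (v : V),
        m₀ ≤ min (weight (x v)) (n - weight (x v)) ∧
        ∀ e, q * weight (discrepancy b (σ.1 e) (x (B.tail e)) (x (B.head e))) ≤
          min (weight (x v)) (n - weight (x v))} ⊆ ⋃ p, ev p := by
    rintro σ ⟨x, v, h⟩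
    exact Set.mem_iUnion.2 ⟨(x, v), h⟩
  refine (measureReal_mono hsub (measure_ne_top _ _)).trans
    ((measureReal_iUnion_fintype_le ev).trans ?_)
  have hone : ∀ p, (B.broderShamir n).real (ev p) ≤
      ((n : ℝ) ^ (j + 3 * Fintype.card V))⁻¹ *
        ∏ v, ((n.choose (weight (p.1 v)) : ℝ))⁻¹ := by
    intro p
    by_cases hp : m₀ ≤ m p
    · have hw := weight_le (p.1 p.2)
      have hchoose : n.choose (m p) = n.choose (weight (p.1 p.2)) := by
        rcases min_choice (weight (p.1 p.2)) (n - weight (p.1 p.2)) with h | h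
        · simp only [m, h]
        · simp only [m, h]; exact Nat.choose_symm hw
      have h1 := hmain n (m p) (m p / q) ((le_max_left _ _).trans hn) hp
        (by simp only [m]; omega) (Nat.mul_div_le _ _)
      rw [hchoose] at h1
      refine le_trans (measureReal_mono ?_ (measure_ne_top _ _))
        (B.broderShamir_discrepancy_le hd hreg (by omega) b _ _ p.1 p.2 h1)
      intro σ hσ e
      rw [Nat.le_div_iff_mul_le hq, mul_comm]
      exact hσ.2 e
    · have : ev p = ∅ := by
        ext σ; simp [hev, hp]
      rw [this, measureReal_empty]
      positivity
  refine (Finset.sum_le_sum fun p _ => hone p).trans ?_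
  rw [Fintype.sum_prod_type_right]
  simp only [← Finset.mul_sum]
  rw [Finset.sum_const, sum_prod_inv_choose_weight, Finset.card_univ, nsmul_eq_mul]
  have h1 : ((Fintype.card V : ℕ) : ℝ) ≤ (n : ℝ) ^ Fintype.card V := by
    exact_mod_cast (Nat.lt_pow_self (by omega : 1 < n)).le
  have h2 : ((n : ℝ) + 1) ^ Fintype.card V ≤ (n : ℝ) ^ (2 * Fintype.card V) := by
    rw [pow_mul]
    exact pow_le_pow_left₀ (by positivity) (by nlinarith) _
  rw [← div_eq_inv_mul, div_le_div_iff₀ (by positivity) (by positivity), one_mul]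
  calc (Fintype.card V : ℝ) * ((n : ℝ) + 1) ^ Fintype.card V * (n : ℝ) ^ j
      ≤ (n : ℝ) ^ Fintype.card V * (n : ℝ) ^ (2 * Fintype.card V) * (n : ℝ) ^ j := by gcongr
    _ = _ := by ring

end MultiGraph

/-! ### Thresholds for the discrete Cheeger inequality -/

/-- If intervals `[lo i, hi i)` have total length at most `δ` times that of the intervals
`[0, c k)`, then some point lies in at most `δ` times as many of the former as of the latter. -/
lemma exists_threshold {ι κ : Type*} [Fintype ι] [Fintype κ] (lo hi : ι → ℝ) (c : κ → ℝ)
    (hlh : ∀ i, lo i ≤ hi i) (hc : ∀ k, 0 ≤ c k) {M : ℝ} (hM : 0 < M) (hcM : ∀ k, c k ≤ M)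
    {δ : ℝ} (h : ∑ i, (hi i - lo i) ≤ δ * ∑ k, c k) :
    ∃ t, 0 ≤ t ∧ t < M ∧ ((Finset.univ.filter fun i => lo i ≤ t ∧ t < hi i).card : ℝ) ≤
      δ * (Finset.univ.filter fun k => t < c k).card := by
  -- `F t` is the excess of the first count over `δ` times the second. Its integral over `[0, M)` is
  -- nonpositive, so some `t` has `F t ≤ 0`.
  set F : ℝ → ℝ := fun t => ∑ i, (Set.Ico (lo i) (hi i)).indicator (fun _ => (1 : ℝ)) t -
    δ * ∑ k, (Set.Ico 0 (c k)).indicator (fun _ => (1 : ℝ)) t with hF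
  have hint : ∀ a b : ℝ, IntegrableOn ((Set.Ico a b).indicator (fun _ => (1 : ℝ)))
      (Set.Ico 0 M) := fun a b =>
    ((integrable_indicator_iff measurableSet_Ico).2
      (by simp [IntegrableOn])).integrableOn
  have hval : ∀ a b : ℝ, ∫ t in Set.Ico 0 M, (Set.Ico a b).indicator (fun _ => (1 : ℝ)) t =
      volume.real (Set.Ico 0 M ∩ Set.Ico a b) := by
    intro a b
    rw [setIntegral_indicator measurableSet_Ico, setIntegral_const, smul_eq_mul, mul_one]
  have hI1 : Integrable (fun t => ∑ i, (Set.Ico (lo i) (hi i)).indicator (fun _ => (1 : ℝ)) t)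
      (volume.restrict (Set.Ico 0 M)) := integrable_finsetSum _ fun i _ => hint _ _
  have hI2 : Integrable (fun t => δ * ∑ k, (Set.Ico 0 (c k)).indicator (fun _ => (1 : ℝ)) t)
      (volume.restrict (Set.Ico 0 M)) :=
    (integrable_finsetSum _ fun i _ => hint _ _).const_mul _
  have hFint : IntegrableOn F (Set.Ico 0 M) := hI1.sub hI2
  have hFval : ∫ t in Set.Ico 0 M, F t ≤ 0 := by
    rw [hF, integral_sub hI1 hI2, integral_const_mul, integral_finsetSum _ fun i _ => hint _ _,
      integral_finsetSum _ fun i _ => hint _ _]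
    simp only [hval]
    have h1 : ∀ k, volume.real (Set.Ico 0 M ∩ Set.Ico 0 (c k)) = c k := by
      intro k
      rw [Set.inter_eq_right.2 (Set.Ico_subset_Ico_right (hcM k)), Real.volume_real_Ico_of_le (hc k),
        sub_zero]
    have h2 : ∀ i, volume.real (Set.Ico 0 M ∩ Set.Ico (lo i) (hi i)) ≤ hi i - lo i := by
      intro i
      rw [← Real.volume_real_Ico_of_le (hlh i)]
      exact measureReal_mono Set.inter_subset_right (by simp)
    rw [Finset.sum_congr rfl fun k _ => h1 k]
    have := Finset.sum_le_sum fun i (_ : i ∈ Finset.univ) => h2 i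
    linarith
  obtain ⟨t, ht, hFt⟩ := exists_le_setAverage (μ := volume) (s := Set.Ico 0 M) (f := F)
    (by simp [hM]) (by simp) hFint
  refine ⟨t, ht.1, ht.2, ?_⟩
  have hneg : F t ≤ 0 := hFt.trans (by
    rw [setAverage_eq]
    exact mul_nonpos_of_nonneg_of_nonpos (by positivity) hFval)
  have e1 : ∑ i, (Set.Ico (lo i) (hi i)).indicator (fun _ => (1 : ℝ)) t =
      (Finset.univ.filter fun i => lo i ≤ t ∧ t < hi i).card := by
    simp [Set.indicator_apply, Finset.sum_boole]
  have e2 : ∑ k, (Set.Ico 0 (c k)).indicator (fun _ => (1 : ℝ)) t =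
      (Finset.univ.filter fun k => t < c k).card := by
    simp [Set.indicator_apply, Finset.sum_boole, ht.1]
  simp only [hF, e1, e2] at hneg
  linarith

/-- The sign of `a` if `a ^ 2` exceeds the threshold `t`, and zero otherwise. -/
noncomputable def signAbove (t a : ℝ) : SignType := if t < a ^ 2 then SignType.sign a else 0

lemma signAbove_neg (t a : ℝ) : signAbove t (-a) = -signAbove t a := by
  unfold signAbove
  rw [neg_sq]
  split_ifs
  · exact Left.sign_neg a
  · rfl

lemma signAbove_eq_zero_iff {t : ℝ} (ht : 0 ≤ t) (a : ℝ) : signAbove t a = 0 ↔ ¬ t < a ^ 2 := by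
  unfold signAbove
  split_ifs with h
  · simp only [sign_eq_zero_iff, h, not_true, iff_false]
    rintro rfl
    norm_num at h
    linarith
  · simp [h]

/-- The lower end of the interval of thresholds that tell `a` from `b`. -/
noncomputable def thresholdLow (a b : ℝ) : ℝ := if 0 ≤ a * b then min (a ^ 2) (b ^ 2) else 0

lemma thresholdLow_le (a b : ℝ) : thresholdLow a b ≤ max (a ^ 2) (b ^ 2) := by
  unfold thresholdLow
  split_ifs
  · exact min_le_max
  · exact le_max_of_le_left (sq_nonneg a)

lemma mem_interval_of_signAbove_ne {t a b : ℝ} (ht : 0 ≤ t) (h : signAbove t a ≠ signAbove t b) :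
    thresholdLow a b ≤ t ∧ t < max (a ^ 2) (b ^ 2) := by
  unfold thresholdLow
  by_cases ha : t < a ^ 2 <;> by_cases hb : t < b ^ 2
  · refine ⟨?_, lt_max_of_lt_left ha⟩
    rw [if_neg]
    · exact ht
    · intro hab
      refine h ?_
      simp only [signAbove, ha, hb, if_true]
      rcases lt_trichotomy a 0 with ha0 | rfl | ha0
      · rcases lt_trichotomy b 0 with hb0 | rfl | hb0
        · rw [sign_neg ha0, sign_neg hb0]
        · norm_num at hb; linarith
        · nlinarith
      · norm_num at ha; linarith
      · rcases lt_trichotomy b 0 with hb0 | rfl | hb0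
        · nlinarith
        · norm_num at hb; linarith
        · rw [sign_pos ha0, sign_pos hb0]
  · refine ⟨?_, lt_max_of_lt_left ha⟩
    split_ifs
    · exact (min_le_right _ _).trans (not_lt.1 hb)
    · exact ht
  · refine ⟨?_, lt_max_of_lt_right hb⟩
    split_ifs
    · exact (min_le_left _ _).trans (not_lt.1 ha)
    · exact ht
  · exact absurd (by simp [signAbove, ha, hb]) h

/-- The length is at most `|a - b| (|a| + |b|)` for equal and for opposite signs. The inequality of
arithmetic and geometric means with parameter `θ` then separates energy from mass, in place of the
Cauchy-Schwarz step of Cheeger's argument. -/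
lemma interval_length_le (a b : ℝ) {θ : ℝ} (hθ : 0 < θ) :
    max (a ^ 2) (b ^ 2) - thresholdLow a b ≤ (a - b) ^ 2 / (2 * θ) + θ * (a ^ 2 + b ^ 2) := by
  have hab : (a - b) ^ 2 ≤ (|a| + |b|) ^ 2 := by
    rw [← sq_abs (a - b)]
    exact pow_le_pow_left₀ (abs_nonneg _) (abs_sub a b) 2
  have h1 : max (a ^ 2) (b ^ 2) - thresholdLow a b ≤ |a - b| * (|a| + |b|) := by
    unfold thresholdLow
    split_ifs with h
    · rw [max_sub_min_eq_abs, abs_sub_comm, sq_sub_sq, abs_mul, mul_comm]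
      exact mul_le_mul_of_nonneg_left (abs_add_le a b) (abs_nonneg _)
    · have h2 : |a - b| = |a| + |b| := by
        rcases le_total 0 a with ha | ha <;> rcases le_total 0 b with hb | hb
        · nlinarith
        · rw [abs_of_nonneg ha, abs_of_nonpos hb, abs_of_nonneg] <;> linarith
        · rw [abs_of_nonpos ha, abs_of_nonneg hb, abs_of_nonpos] <;> linarith
        · nlinarith
      rw [h2, sub_zero, max_le_iff, ← sq_abs a, ← sq_abs b]
      constructor <;> nlinarith [abs_nonneg a, abs_nonneg b]
  refine h1.trans ?_
  have h3 : (|a| + |b|) ^ 2 ≤ 2 * (a ^ 2 + b ^ 2) := by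
    rw [← sq_abs a, ← sq_abs b]; nlinarith [sq_nonneg (|a| - |b|)]
  have h4 : |a - b| * (|a| + |b|) ≤ |a - b| ^ 2 / (2 * θ) + θ * (|a| + |b|) ^ 2 / 2 := by
    rw [div_add_div _ _ (by positivity) (by positivity), le_div_iff₀ (by positivity)]
    nlinarith [sq_nonneg (|a - b| - θ * (|a| + |b|))]
  rw [sq_abs] at h4
  nlinarith

lemma sum_sq_pos {V : Type*} [Fintype V] {f : V → ℝ} (hf : f ≠ 0) : 0 < ∑ x, f x ^ 2 := by
  obtain ⟨x, hx⟩ := Function.ne_iff.1 hf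
  exact Finset.sum_pos' (fun x _ => sq_nonneg _) ⟨x, Finset.mem_univ _, by
    have : f x ≠ 0 := hx
    positivity⟩

/-! ### Eigenfunctions and sparse cuts -/

namespace MultiGraph

variable {V : Type u} {E : Type v} [Fintype E]

lemma sum_comp_inv (G : MultiGraph V E) (g : E → ℝ) : ∑ e, g (G.inv e) = ∑ e, g e :=
  Equiv.sum_comp (⟨G.inv, G.inv, G.inv_inv, G.inv_inv⟩ : Equiv.Perm E) g

variable [Fintype V] [DecidableEq V]

/-- `f` is an eigenfunction of the adjacency operator with eigenvalue `μ` (possibly zero). -/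
def IsEigenfunction (G : MultiGraph V E) (f : V → ℝ) (μ : ℝ) : Prop :=
  ∀ x, ∑ e with G.tail e = x, f (G.head e) = μ * f x

lemma sum_tail (G : MultiGraph V E) {d : ℕ} (hreg : G.IsRegular d) (g : V → ℝ) :
    ∑ e, g (G.tail e) = d * ∑ x, g x := by
  rw [← Finset.sum_fiberwise (s := Finset.univ) (g := G.tail), Finset.mul_sum]
  refine Finset.sum_congr rfl fun x _ => ?_
  rw [Finset.sum_congr rfl fun e he => by rw [(Finset.mem_filter.1 he).2], Finset.sum_const,
    G.card_filter_tail_eq hreg, nsmul_eq_mul]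

lemma sum_head (G : MultiGraph V E) {d : ℕ} (hreg : G.IsRegular d) (g : V → ℝ) :
    ∑ e, g (G.head e) = d * ∑ x, g x := by
  rw [← G.sum_tail hreg, ← G.sum_comp_inv]
  simp only [G.head_inv]

lemma sum_tail_mul_head (G : MultiGraph V E) (g f : V → ℝ) :
    ∑ e, g (G.tail e) * f (G.head e) =
      ∑ x, g x * ∑ e with G.tail e = x, f (G.head e) := by
  rw [← Finset.sum_fiberwise (s := Finset.univ) (g := G.tail)]
  refine Finset.sum_congr rfl fun x _ => ?_
  rw [Finset.mul_sum]
  exact Finset.sum_congr rfl fun e he => by rw [(Finset.mem_filter.1 he).2]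

/-- For `s = 1` this is the quadratic form of `d - A`, for `s = -1` that of `d + A`, each doubled.
-/
lemma sum_sq_sub (G : MultiGraph V E) {d : ℕ} (hreg : G.IsRegular d) (f : V → ℝ) {s : ℝ}
    (hs : s ^ 2 = 1) :
    ∑ e, (f (G.tail e) - s * f (G.head e)) ^ 2 =
      2 * d * ∑ x, f x ^ 2 - 2 * s * ∑ x, f x * ∑ e with G.tail e = x, f (G.head e) := by
  have h1 : ∀ e, (f (G.tail e) - s * f (G.head e)) ^ 2 =
      f (G.tail e) ^ 2 + f (G.head e) ^ 2 - 2 * s * (f (G.tail e) * f (G.head e)) := by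
    intro e
    linear_combination f (G.head e) ^ 2 * hs
  rw [Finset.sum_congr rfl fun e _ => h1 e, Finset.sum_sub_distrib, Finset.sum_add_distrib,
    ← Finset.mul_sum, sum_tail_mul_head, G.sum_tail hreg fun x => f x ^ 2,
    G.sum_head hreg fun x => f x ^ 2]
  ring

lemma sum_mul_eigen (G : MultiGraph V E) {f : V → ℝ} {μ : ℝ} (hf : G.IsEigenfunction f μ) :
    ∑ x, f x * ∑ e with G.tail e = x, f (G.head e) = μ * ∑ x, f x ^ 2 := by
  rw [Finset.mul_sum]
  exact Finset.sum_congr rfl fun x _ => by rw [hf x]; ring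

lemma IsEigenfunction.le_degree {G : MultiGraph V E} {d : ℕ} (hreg : G.IsRegular d) {f : V → ℝ}
    {μ : ℝ} (hf : G.IsEigenfunction f μ) (h0 : f ≠ 0) : μ ≤ d := by
  have h := G.sum_sq_sub hreg f (s := 1) (by norm_num)
  rw [G.sum_mul_eigen hf] at h
  have h1 : 0 ≤ ∑ e, (f (G.tail e) - 1 * f (G.head e)) ^ 2 := Finset.sum_nonneg fun e _ => sq_nonneg _
  have h2 := sum_sq_pos h0
  by_contra hlt
  push Not at hlt
  nlinarith

lemma IsEigenfunction.sum_eq_zero {G : MultiGraph V E} {d : ℕ} (hreg : G.IsRegular d) {f : V → ℝ}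
    {μ : ℝ} (hf : G.IsEigenfunction f μ) (hμ : μ ≠ d) : ∑ x, f x = 0 := by
  have h := G.sum_tail_mul_head (fun _ => 1) f
  simp only [one_mul] at h
  rw [G.sum_head hreg, Finset.sum_congr rfl fun x _ => hf x, ← Finset.mul_sum] at h
  have : (d - μ) * ∑ x, f x = 0 := by linarith
  rcases mul_eq_zero.1 this with h | h
  · exact absurd (by linarith) hμ
  · exact h

/-- If `f` has nonzero sum then `μ = d`, and `μ ≤ ν ≤ d` makes `f` and `g` independent
eigenfunctions for `d`; a combination of them has sum zero. Thus a multiple top eigenvalue, as in a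
disconnected cover, needs no separate treatment. -/
lemma exists_eigenfunction_sum_zero {G : MultiGraph V E} {d : ℕ} (hreg : G.IsRegular d)
    {f g : V → ℝ} {μ ν : ℝ} (hf : G.IsEigenfunction f μ) (hg : G.IsEigenfunction g ν)
    (hff : ∑ x, f x * f x = 1) (hgg : ∑ x, g x * g x = 1) (hfg : ∑ x, f x * g x = 0)
    (hμν : μ ≤ ν) :
    ∃ h : V → ℝ, G.IsEigenfunction h μ ∧ h ≠ 0 ∧ ∑ x, h x = 0 := by
  have hf0 : f ≠ 0 := by rintro rfl; simp at hff
  have hg0 : g ≠ 0 := by rintro rfl; simp at hgg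
  by_cases hs : ∑ x, f x = 0
  · exact ⟨f, hf, hf0, hs⟩
  have hμ : μ = d := by
    by_contra hμ; exact hs (hf.sum_eq_zero hreg hμ)
  have hν : ν = μ := le_antisymm ((hg.le_degree hreg hg0).trans_eq hμ.symm) hμν
  subst hν
  refine ⟨fun x => (∑ y, g y) * f x - (∑ y, f y) * g x, fun x => ?_, fun h0 => hs ?_, ?_⟩
  · rw [Finset.sum_sub_distrib, ← Finset.mul_sum, ← Finset.mul_sum, hf x, hg x]; ring
  · have h1 : ∑ x, ((∑ y, g y) * f x - (∑ y, f y) * g x) * g x = 0 :=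
      Finset.sum_eq_zero fun x _ => by rw [show _ - _ = (0 : ℝ) from congrFun h0 x, zero_mul]
    have h2 : ∑ x, ((∑ y, g y) * f x - (∑ y, f y) * g x) * g x =
        (∑ y, g y) * ∑ x, f x * g x - (∑ y, f y) * ∑ x, g x * g x := by
      rw [Finset.mul_sum, Finset.mul_sum, ← Finset.sum_sub_distrib]
      exact Finset.sum_congr rfl fun x _ => by ring
    rw [h2, hfg, hgg] at h1
    linarith
  · rw [Finset.sum_sub_distrib, ← Finset.mul_sum, ← Finset.mul_sum]; ring

lemma adjMatrix_mulVec (G : MultiGraph V E) (f : V → ℝ) (x : V) :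
    G.adjMatrix.mulVec f x = ∑ e with G.tail e = x, f (G.head e) := by
  classical
  rw [Matrix.mulVec, dotProduct,
    ← Finset.sum_fiberwise (s := Finset.univ.filter fun e => G.tail e = x) (g := G.head)]
  refine Finset.sum_congr rfl fun y _ => ?_
  rw [Finset.sum_congr rfl fun e he => by rw [(Finset.mem_filter.1 he).2], Finset.sum_const,
    nsmul_eq_mul, adjMatrix, Nat.card_eq_fintype_card, Fintype.card_subtype, Finset.filter_filter]

lemma exists_orthonormal_eigenfunctions (G : MultiGraph V E) :
    ∃ F : Fin (Fintype.card V) → V → ℝ, (∀ i, G.IsEigenfunction (F i) (G.eigenvalue i)) ∧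
      ∀ i k, ∑ x, F i x * F k x = if i = k then 1 else 0 := by
  classical
  set hA := G.adjMatrix_isHermitian
  let φ : Fin (Fintype.card V) ≃ V := Fintype.equivOfCardEq (Fintype.card_fin _)
  refine ⟨fun i x => hA.eigenvectorBasis (φ i) x, fun i x => ?_, fun i k => ?_⟩
  · have h := congrFun (hA.mulVec_eigenvectorBasis (φ i)) x
    rw [adjMatrix_mulVec] at h
    refine h.trans ?_
    simp only [Pi.smul_apply, smul_eq_mul, Matrix.IsHermitian.eigenvalues, eigenvalue]
    congr 2
    exact φ.symm_apply_apply i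
  · have h := hA.eigenvectorBasis.orthonormal
    rw [orthonormal_iff_ite] at h
    have h1 := h (φ k) (φ i)
    simp only [φ.injective.eq_iff] at h1
    simp only [eq_comm (a := i)]
    rw [← h1, PiLp.inner_apply]
    simp

/-- A function with small energy has a level set pair with few bad edges. -/
lemma exists_threshold_of_sum_sq_le (G : MultiGraph V E) {d : ℕ} (hd : 0 < d)
    (hreg : G.IsRegular d) {δ : ℝ} (hδ : 0 < δ) {f : V → ℝ} (hf : f ≠ 0) {s : ℝ} (hs : s ^ 2 = 1)
    (h : ∑ e, (f (G.tail e) - s * f (G.head e)) ^ 2 ≤ 2 * (δ ^ 2 / (8 * d)) * ∑ x, f x ^ 2) :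
    ∃ t : ℝ, 0 ≤ t ∧ (∃ x, t < f x ^ 2) ∧
      ((Finset.univ.filter fun e =>
        signAbove t (f (G.tail e)) ≠ signAbove t (s * f (G.head e))).card : ℝ) ≤
      δ * (Finset.univ.filter fun x => t < f x ^ 2).card := by
  classical
  obtain ⟨x₀, hx₀⟩ := Function.ne_iff.1 hf
  obtain ⟨x₁, -, hx₁⟩ := Finset.exists_max_image Finset.univ (fun x => f x ^ 2)
    ⟨x₀, Finset.mem_univ _⟩
  have hM : 0 < f x₁ ^ 2 := lt_of_lt_of_le (by
    have : f x₀ ≠ 0 := hx₀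
    positivity) (hx₁ x₀ (Finset.mem_univ _))
  have hd' : (0 : ℝ) < d := by exact_mod_cast hd
  -- With this `θ`, the energy term and the mass term each contribute `δ / 2` times the mass.
  have hθ : 0 < δ / (4 * d) := by positivity
  obtain ⟨t, ht0, ht1, ht⟩ := exists_threshold
    (fun e => thresholdLow (f (G.tail e)) (s * f (G.head e)))
    (fun e => max (f (G.tail e) ^ 2) ((s * f (G.head e)) ^ 2)) (fun x => f x ^ 2)
    (fun e => thresholdLow_le _ _) (fun x => sq_nonneg _) hM (fun x => hx₁ x (Finset.mem_univ _))
    (δ := δ) (by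
      refine (Finset.sum_le_sum fun e _ => interval_length_le _ _ hθ).trans ?_
      have h1 : ∀ e, (s * f (G.head e)) ^ 2 = f (G.head e) ^ 2 := fun e => by
        rw [mul_pow, hs, one_mul]
      simp only [h1]
      rw [Finset.sum_add_distrib, ← Finset.sum_div, ← Finset.mul_sum, Finset.sum_add_distrib,
        G.sum_tail hreg fun x => f x ^ 2, G.sum_head hreg fun x => f x ^ 2]
      have h2 := div_le_div_of_nonneg_right h (by positivity : 0 ≤ 2 * (δ / (4 * d)))
      have h3 : 2 * (δ ^ 2 / (8 * d)) * (∑ x, f x ^ 2) / (2 * (δ / (4 * d))) =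
          δ / 2 * ∑ x, f x ^ 2 := by field_simp; ring
      have h4 : δ / (4 * d) * (d * ∑ x, f x ^ 2 + d * ∑ x, f x ^ 2) = δ / 2 * ∑ x, f x ^ 2 := by
        field_simp; ring
      rw [h3] at h2
      linarith)
  refine ⟨t, ht0, ⟨x₁, ht1⟩, le_trans ?_ ht⟩
  norm_cast
  refine Finset.card_le_card fun e he => ?_
  rw [Finset.mem_filter] at he ⊢
  exact ⟨he.1, mem_interval_of_signAbove_ne ht0 he.2⟩

/-- The number of directed edges between a vertex set and its complement. -/
def cutCard (G : MultiGraph V E) (S : V → Bool) : ℕ :=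
  (Finset.univ.filter fun e => S (G.tail e) ≠ S (G.head e)).card

/-- The number of directed edges that do not cross from a vertex set to its complement. -/
def uncutCard (G : MultiGraph V E) (S : V → Bool) : ℕ :=
  (Finset.univ.filter fun e => S (G.tail e) = S (G.head e)).card

/-- The positive part `g` satisfies `μ g² ≤ g · A g` pointwise since `g ≥ f`, so its energy is small
as well, and its level sets lie in `{f > 0}`, at most half of the vertices. -/
lemma exists_small_cut_of_posPart (G : MultiGraph V E) {d : ℕ} (hd : 0 < d)
    (hreg : G.IsRegular d) {δ : ℝ} (hδ : 0 < δ) {f : V → ℝ} {μ : ℝ} (hf : G.IsEigenfunction f μ)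
    (hμ : d - δ ^ 2 / (8 * d) ≤ μ) (hpos : ∃ x, 0 < f x)
    (hcard : 2 * (Finset.univ.filter fun x => 0 < f x).card ≤ Fintype.card V) :
    ∃ S : V → Bool, 0 < weight S ∧ 2 * weight S ≤ Fintype.card V ∧
      (G.cutCard S : ℝ) ≤ δ * weight S := by
  set g : V → ℝ := fun x => max (f x) 0 with hg
  have hg0 : g ≠ 0 := by
    obtain ⟨x, hx⟩ := hpos
    intro h
    have := congrFun h x
    simp only [hg, Pi.zero_apply, max_eq_right_iff] at this
    linarith
  have hgf : ∀ x, μ * g x ^ 2 ≤ g x * ∑ e with G.tail e = x, g (G.head e) := by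
    intro x
    have h1 : μ * f x ≤ ∑ e with G.tail e = x, g (G.head e) := by
      rw [← hf x]
      exact Finset.sum_le_sum fun e _ => le_max_left _ _
    rcases le_total (f x) 0 with h | h
    · simp [hg, h]
    · have h2 : g x = f x := max_eq_left h
      rw [h2]
      nlinarith
  have hen : ∑ e, (g (G.tail e) - 1 * g (G.head e)) ^ 2 ≤
      2 * (δ ^ 2 / (8 * d)) * ∑ x, g x ^ 2 := by
    rw [G.sum_sq_sub hreg g (by norm_num)]
    have h1 := Finset.sum_le_sum fun x (_ : x ∈ Finset.univ) => hgf x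
    rw [← Finset.mul_sum] at h1
    have h2 := sum_sq_pos hg0
    nlinarith
  obtain ⟨t, ht0, ⟨x, hx⟩, ht⟩ := G.exists_threshold_of_sum_sq_le hd hreg hδ hg0 (by norm_num) hen
  have hw : weight (fun x => decide (t < g x ^ 2)) =
      (Finset.univ.filter fun x => t < g x ^ 2).card := by simp [weight]
  refine ⟨fun x => decide (t < g x ^ 2), ?_, ?_, ?_⟩
  · rw [hw]
    exact Finset.card_pos.2 ⟨x, by simp [hx]⟩
  · rw [hw]
    refine le_trans (Nat.mul_le_mul_left 2 (Finset.card_le_card fun y hy => ?_)) hcard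
    rw [Finset.mem_filter] at hy ⊢
    refine ⟨hy.1, not_le.1 fun hle => ?_⟩
    have : g y = 0 := max_eq_right hle
    rw [this] at hy
    norm_num at hy
    linarith
  · rw [hw]
    refine le_trans ?_ ht
    norm_cast
    refine Finset.card_le_card fun e he => ?_
    rw [Finset.mem_filter] at he ⊢
    refine ⟨he.1, fun heq => he.2 ?_⟩
    rw [one_mul] at heq
    have : signAbove t (g (G.tail e)) = 0 ↔ signAbove t (g (G.head e)) = 0 := by rw [heq]
    rw [signAbove_eq_zero_iff ht0, signAbove_eq_zero_iff ht0, not_iff_not] at this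
    exact decide_eq_decide.2 this

/-- A large eigenvalue with an eigenfunction of sum zero gives a set with small boundary. -/
lemma exists_small_cut (G : MultiGraph V E) {d : ℕ} (hd : 0 < d)
    (hreg : G.IsRegular d) {δ : ℝ} (hδ : 0 < δ) {f : V → ℝ} {μ : ℝ} (hf : G.IsEigenfunction f μ)
    (hμ : d - δ ^ 2 / (8 * d) ≤ μ) (hf0 : f ≠ 0) (hsum : ∑ x, f x = 0) :
    ∃ S : V → Bool, 0 < weight S ∧ 2 * weight S ≤ Fintype.card V ∧
      (G.cutCard S : ℝ) ≤ δ * weight S := by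
  obtain ⟨x₀, hx₀⟩ := Function.ne_iff.1 hf0
  have hpos : ∃ x, 0 < f x := by
    by_contra h
    push Not at h
    exact hx₀ ((Finset.sum_eq_zero_iff_of_nonpos fun x _ => h x).1 hsum x₀ (Finset.mem_univ _))
  have hneg : ∃ x, 0 < -f x := by
    by_contra h
    push Not at h
    exact hx₀ ((Finset.sum_eq_zero_iff_of_nonneg fun x _ => by
      have := h x; linarith).1 hsum x₀ (Finset.mem_univ _))
  by_cases hcard : 2 * (Finset.univ.filter fun x => 0 < f x).card ≤ Fintype.card V
  · exact G.exists_small_cut_of_posPart hd hreg hδ hf hμ hpos hcard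
  · refine G.exists_small_cut_of_posPart hd hreg hδ (f := fun x => -f x) (fun x => ?_) hμ hneg ?_
    · rw [Finset.sum_neg_distrib, hf x]; ring
    · have h1 : Disjoint (Finset.univ.filter fun x => 0 < f x)
          (Finset.univ.filter fun x => 0 < -f x) := by
        rw [Finset.disjoint_filter]
        intro x _ h h'
        linarith
      have h2 := Finset.card_le_univ ((Finset.univ.filter fun x => 0 < f x) ∪
          (Finset.univ.filter fun x => 0 < -f x))
      rw [Finset.card_union_of_disjoint h1] at h2
      omega

/-- A very negative eigenvalue gives a set with small boundary, or a cut that almost all edges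
cross. -/
lemma exists_small_cut_or_uncut (G : MultiGraph V E) {d : ℕ} (hd : 0 < d)
    (hreg : G.IsRegular d) {δ : ℝ} (hδ : 0 < δ) {f : V → ℝ} {μ : ℝ} (hf : G.IsEigenfunction f μ)
    (hμ : μ ≤ -(d - (δ ^ 2 / (δ + d)) ^ 2 / (8 * d))) (hf0 : f ≠ 0) :
    (∃ S : V → Bool, 0 < weight S ∧ 2 * weight S ≤ Fintype.card V ∧
      (G.cutCard S : ℝ) ≤ δ * weight S) ∨
    ∃ S : V → Bool, (G.uncutCard S : ℝ) ≤ δ * Fintype.card V := by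
  classical
  have hd' : (0 : ℝ) < d := by exact_mod_cast hd
  -- This `η` solves `η + d η / δ = δ`, which balances the two kinds of uncut edges at the end.
  set η : ℝ := δ ^ 2 / (δ + d) with hη
  have hη0 : 0 < η := by positivity
  have hηδ : η ≤ δ := by
    rw [hη, div_le_iff₀ (by positivity)]; nlinarith
  have hηeq : η + d * (η / δ) = δ := by
    rw [hη]; field_simp
  have hen : ∑ e, (f (G.tail e) - (-1) * f (G.head e)) ^ 2 ≤
      2 * (η ^ 2 / (8 * d)) * ∑ x, f x ^ 2 := by
    rw [G.sum_sq_sub hreg f (by norm_num), G.sum_mul_eigen hf]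
    have h2 := sum_sq_pos hf0
    nlinarith
  obtain ⟨t, ht0, ⟨x, hx⟩, ht⟩ := G.exists_threshold_of_sum_sq_le hd hreg hη0 hf0 (by norm_num) hen
  set U : Finset V := Finset.univ.filter fun x => t < f x ^ 2 with hU
  have hUcard : U.card ≤ Fintype.card V := Finset.card_le_univ _
  have hUcard' : (U.card : ℝ) ≤ Fintype.card V := by exact_mod_cast hUcard
  set N : ℝ := ((Fintype.card V : ℕ) : ℝ) with hN
  set bad := Finset.univ.filter fun e =>
    signAbove t (f (G.tail e)) ≠ signAbove t (-1 * f (G.head e)) with hbad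
  have hw : weight (fun x => decide (t < f x ^ 2)) = U.card := by simp [weight, hU]
  have hw' : weight (fun x => decide (¬ t < f x ^ 2)) = Fintype.card V - U.card := by
    have := Finset.card_filter_add_card_filter_not (s := (Finset.univ : Finset V))
      (fun x => t < f x ^ 2)
    rw [Finset.card_univ, ← hU] at this
    simp only [weight, decide_eq_true_eq]
    omega
  have hcut : G.cutCard (fun x => decide (t < f x ^ 2)) ≤ bad.card := by
    refine Finset.card_le_card fun e he => ?_
    rw [Finset.mem_filter] at he ⊢
    refine ⟨he.1, fun heq => he.2 ?_⟩
    have : signAbove t (f (G.tail e)) = 0 ↔ signAbove t (-1 * f (G.head e)) = 0 := by rw [heq]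
    rw [signAbove_eq_zero_iff ht0, signAbove_eq_zero_iff ht0, not_iff_not, neg_one_mul,
      neg_sq] at this
    exact decide_eq_decide.2 this
  have hcut' : G.cutCard (fun x => decide (¬ t < f x ^ 2)) ≤ bad.card := by
    refine le_trans (le_of_eq ?_) hcut
    unfold cutCard
    congr 1
    ext e
    simp only [Finset.mem_filter, Finset.mem_univ, true_and, ne_eq, decide_eq_decide, not_iff_not]
  have hbadN : (bad.card : ℝ) ≤ η * N := ht.trans (mul_le_mul_of_nonneg_left hUcard' hη0.le)
  have hUpos : 0 < U.card := Finset.card_pos.2 ⟨x, by simp [hU, hx]⟩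
  by_cases hUh : 2 * U.card ≤ Fintype.card V
  · refine Or.inl ⟨fun x => decide (t < f x ^ 2), by rw [hw]; exact hUpos, by rw [hw]; exact hUh, ?_⟩
    rw [hw]
    exact le_trans (by exact_mod_cast hcut) (ht.trans
      (mul_le_mul_of_nonneg_right hηδ (Nat.cast_nonneg _)))
  -- Either the complement of `U` is large enough to be the sparse set, or it holds less than a
  -- fraction `η / δ` of the vertices and the signs on `U` give an almost complete cut.
  by_cases hW : η * N ≤ δ * (N - U.card)
  · refine Or.inl ⟨fun x => decide (¬ t < f x ^ 2), ?_, ?_, ?_⟩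
    · rw [hw']
      have h1 : (0 : ℝ) < N := lt_of_lt_of_le (by exact_mod_cast hUpos) hUcard'
      have h2 : 0 < N - U.card := by
        by_contra h
        push Not at h
        nlinarith [mul_pos hη0 h1]
      have : U.card < Fintype.card V := by
        have : (U.card : ℝ) < Fintype.card V := by linarith
        exact_mod_cast this
      omega
    · rw [hw']; omega
    · rw [hw', Nat.cast_sub hUcard]
      exact le_trans (by exact_mod_cast hcut') (hbadN.trans hW)
  · push Not at hW
    refine Or.inr ⟨fun x => decide (signAbove t (f x) = 1), ?_⟩
    -- Along a good edge the thresholded signs are opposite, so an uncut good edge has sign zero at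
    -- its tail.
    have hsub : (Finset.univ.filter fun e => decide (signAbove t (f (G.tail e)) = 1) =
        decide (signAbove t (f (G.head e)) = 1)) ⊆
        bad ∪ Finset.univ.filter fun e => ¬ t < f (G.tail e) ^ 2 := by
      intro e he
      rw [Finset.mem_filter, decide_eq_decide] at he
      rw [Finset.mem_union, or_iff_not_imp_left]
      intro hb
      simp only [hbad, Finset.mem_filter, Finset.mem_univ, true_and, ne_eq, not_not, neg_one_mul,
        signAbove_neg] at hb
      rw [Finset.mem_filter, ← signAbove_eq_zero_iff ht0]
      refine ⟨Finset.mem_univ _, ?_⟩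
      have h2 := he.2
      rw [hb] at h2 ⊢
      generalize signAbove t (f (G.head e)) = a at h2
      revert h2
      cases a <;> decide
    have h1 := (Finset.card_le_card hsub).trans (Finset.card_union_le _ _)
    have h2 : ((Finset.univ.filter fun e => ¬ t < f (G.tail e) ^ 2).card : ℝ) =
        d * (N - U.card) := by
      have h3 := G.sum_tail hreg fun x => if ¬ t < f x ^ 2 then (1 : ℝ) else 0
      rw [Finset.sum_boole, Finset.sum_boole] at h3
      rw [h3]
      have h4 := Finset.card_filter_add_card_filter_not (s := (Finset.univ : Finset V))
        (fun x => t < f x ^ 2)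
      rw [Finset.card_univ] at h4
      have h5 : (U.card : ℝ) + (Finset.univ.filter fun x => ¬ t < f x ^ 2).card = N := by
        rw [hN]; exact_mod_cast h4
      rw [← h5]; ring
    have h3 : (G.uncutCard (fun x => decide (signAbove t (f x) = 1)) : ℝ) ≤
        bad.card + d * (N - U.card) := by
      rw [← h2]; exact_mod_cast h1
    have h4 : N - U.card ≤ η / δ * N := by
      rw [div_mul_eq_mul_div, le_div_iff₀ hδ]; linarith
    calc _ ≤ _ := h3
      _ ≤ η * N + d * (η / δ * N) := add_le_add hbadN (mul_le_mul_of_nonneg_left h4 hd'.le)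
      _ = (η + d * (η / δ)) * N := by ring
      _ = δ * N := by rw [hηeq]

end MultiGraph

/-! ### Cuts of a cover, fibre by fibre -/

lemma weight_le_weight_add_discrepancy {n : ℕ} (σ : Equiv.Perm (Fin n)) (x y : Fin n → Bool) :
    weight x ≤ weight y + weight (discrepancy false σ x y) := by
  classical
  rw [← weight_comp_perm y σ]
  unfold weight
  refine (Finset.card_le_card fun i hi => ?_).trans (Finset.card_union_le _ _)
  simp only [Finset.mem_union, Finset.mem_filter, Finset.mem_univ, true_and,
    Function.comp_apply] at hi ⊢
  by_cases hy : y (σ i) = true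
  · exact Or.inl hy
  · exact Or.inr (by simp [discrepancy, hi, hy])

lemma weight_le_weight_add_discrepancy' {n : ℕ} (σ : Equiv.Perm (Fin n)) (x y : Fin n → Bool) :
    weight y ≤ weight x + weight (discrepancy false σ x y) := by
  classical
  rw [← weight_comp_perm y σ]
  unfold weight
  refine (Finset.card_le_card fun i hi => ?_).trans (Finset.card_union_le _ _)
  simp only [Finset.mem_union, Finset.mem_filter, Finset.mem_univ, true_and,
    Function.comp_apply] at hi ⊢
  by_cases hx : x i = true
  · exact Or.inl hx
  · exact Or.inr (by simp [discrepancy, hi, hx])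

lemma discrepancy_true {n : ℕ} (σ : Equiv.Perm (Fin n)) (x y : Fin n → Bool) :
    discrepancy true σ x y = discrepancy false σ x (fun i => !y i) := by
  funext i
  simp only [discrepancy]
  cases x i <;> cases y (σ i) <;> rfl

lemma weight_eq_sum_fibers {V : Type*} [Fintype V] {n : ℕ} (S : V × Fin n → Bool) :
    weight S = ∑ v, weight fun i => S (v, i) := by
  simp only [weight, Finset.card_filter]
  exact Fintype.sum_prod_type _

namespace MultiGraph

variable {V : Type u} {E : Type v}

lemma cover_isRegular (B : MultiGraph V E) {d : ℕ} (hreg : B.IsRegular d) {n : ℕ}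
    (σ : B.PermAssignment n) : (B.cover σ).IsRegular d := by
  rintro ⟨x, i⟩
  rw [← hreg x]
  refine Nat.card_congr ⟨fun p => ⟨p.1.1, (Prod.ext_iff.1 p.2).1⟩,
    fun e => ⟨(e.1, i), Prod.ext e.2 rfl⟩, fun p => ?_, fun e => rfl⟩
  exact Subtype.ext (Prod.ext rfl (Prod.ext_iff.1 p.2).2.symm)

lemma cover_cutCard [Fintype E] (B : MultiGraph V E) {n : ℕ} (σ : B.PermAssignment n)
    (S : V × Fin n → Bool) : (B.cover σ).cutCard S = ∑ e, weight (discrepancy false (σ.1 e)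
      (fun i => S (B.tail e, i)) (fun i => S (B.head e, i))) := by
  simp only [weight, cutCard, Finset.card_filter]
  rw [Fintype.sum_prod_type]
  refine Finset.sum_congr rfl fun e _ => Finset.sum_congr rfl fun i _ =>
    if_congr ?_ rfl rfl
  simp [cover, discrepancy]

lemma cover_uncutCard [Fintype E] (B : MultiGraph V E) {n : ℕ} (σ : B.PermAssignment n)
    (S : V × Fin n → Bool) : (B.cover σ).uncutCard S = ∑ e, weight (discrepancy true (σ.1 e)
      (fun i => S (B.tail e, i)) (fun i => S (B.head e, i))) := by
  simp only [weight, uncutCard, Finset.card_filter]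
  rw [Fintype.sum_prod_type]
  refine Finset.sum_congr rfl fun e _ => Finset.sum_congr rfl fun i _ =>
    if_congr ?_ rfl rfl
  simp [cover, discrepancy]

lemma component_ncard_le_weight [Fintype V] [Fintype E] (G : MultiGraph V E) {S : V → Bool}
    (hcut : G.cutCard S = 0) {x : V} (hx : S x = true) : (G.component x).ncard ≤ weight S := by
  have hstep : ∀ e, S (G.tail e) = S (G.head e) := by
    intro e
    by_contra h
    exact absurd hcut (Finset.card_pos.2 ⟨e, Finset.mem_filter.2 ⟨Finset.mem_univ _, h⟩⟩).ne'
  have hsub : G.component x ⊆ (Finset.univ.filter fun y => S y = true : Finset V) := by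
    intro y hy
    have hy' : G.Reachable x y := hy
    rw [Finset.mem_coe, Finset.mem_filter]
    refine ⟨Finset.mem_univ _, ?_⟩
    induction hy' with
    | refl => exact hx
    | tail _ h ih =>
      obtain ⟨e, rfl, rfl⟩ := h
      rw [← hstep]
      exact ih (by assumption)
  exact (Set.ncard_le_ncard hsub (Finset.finite_toSet _)).trans_eq (Set.ncard_coe_finset _)

/-- Conjugation by the sign of the bipartition negates the adjacency operator. -/
lemma IsEigenfunction.mul_sign [DecidableEq V] [Fintype E] {G : MultiGraph V E} {c : V → Bool}
    (hc : ∀ e, c (G.tail e) ≠ c (G.head e)) {f : V → ℝ} {μ : ℝ} (hf : G.IsEigenfunction f μ) :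
    G.IsEigenfunction (fun x => (if c x = true then 1 else -1) * f x) (-μ) := by
  intro x
  have h1 : ∀ e ∈ Finset.univ.filter fun e => G.tail e = x,
      (if c (G.head e) = true then (1 : ℝ) else -1) * f (G.head e) =
        -(if c x = true then (1 : ℝ) else -1) * f (G.head e) := by
    intro e he
    have h2 := hc e
    rw [(Finset.mem_filter.1 he).2] at h2
    cases hx : c x <;> cases hy : c (G.head e) <;> simp_all
  rw [Finset.sum_congr rfl h1, ← Finset.mul_sum, hf x]
  ring

variable [Fintype V] [Fintype E]

/-- In a cover of a connected graph, a set of at most half the vertices with small boundary has a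
fibre that is neither nearly empty nor nearly full. -/
lemma exists_balanced_fiber_of_cut (B : MultiGraph V E) (hconn : B.IsConnected) {n : ℕ}
    (σ : B.PermAssignment n) {S : V × Fin n → Bool} (hS : 0 < weight S)
    (hhalf : 2 * weight S ≤ Fintype.card V * n)
    (hcut : 2 * Fintype.card V * (B.cover σ).cutCard S ≤ weight S) :
    ∃ v, weight S ≤ 2 * Fintype.card V *
      min (weight fun i => S (v, i)) (n - weight fun i => S (v, i)) := by
  set s : V → ℕ := fun v => weight fun i => S (v, i) with hs
  have hsn : ∀ v, s v ≤ n := fun v => weight_le _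
  obtain ⟨v₀⟩ := hconn.1
  have hν : 0 < Fintype.card V := Fintype.card_pos_iff.2 ⟨v₀⟩
  by_contra hno
  push Not at hno
  -- Without a balanced fibre, every fibre is less than a quarter or more than three quarters full.
  -- The cut has at most `n / 4` edges, so adjacent fibres are of the same kind, and by
  -- connectedness all are.
  have hdich : ∀ v, 4 * min (s v) (n - s v) < n := by
    intro v
    have h1 : 2 * Fintype.card V * min (s v) (n - s v) < weight S := hno v
    refine Nat.lt_of_mul_lt_mul_left (a := Fintype.card V) ?_
    calc Fintype.card V * (4 * min (s v) (n - s v))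
        = 2 * (2 * Fintype.card V * min (s v) (n - s v)) := by ring
      _ < 2 * weight S := by omega
      _ ≤ _ := hhalf
  have hcutn : 4 * (B.cover σ).cutCard S ≤ n := by
    refine Nat.le_of_mul_le_mul_left (?_ : Fintype.card V * _ ≤ Fintype.card V * _) hν
    calc Fintype.card V * (4 * (B.cover σ).cutCard S)
        = 2 * (2 * Fintype.card V * (B.cover σ).cutCard S) := by ring
      _ ≤ 2 * weight S := by omega
      _ ≤ _ := hhalf
  have hedge : ∀ e, 2 * s (B.tail e) < n ↔ 2 * s (B.head e) < n := by
    intro e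
    have h1 : weight (discrepancy false (σ.1 e)
      (fun i => S (B.tail e, i)) (fun i => S (B.head e, i))) ≤ (B.cover σ).cutCard S := by
      rw [cover_cutCard]
      exact Finset.single_le_sum (f := fun e => weight (discrepancy false (σ.1 e)
        (fun i => S (B.tail e, i)) (fun i => S (B.head e, i)))) (fun _ _ => Nat.zero_le _)
        (Finset.mem_univ e)
    have h2 : s (B.tail e) ≤ _ := weight_le_weight_add_discrepancy (σ.1 e)
      (fun i => S (B.tail e, i)) (fun i => S (B.head e, i))
    have h3 : s (B.head e) ≤ _ := weight_le_weight_add_discrepancy' (σ.1 e)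
      (fun i => S (B.tail e, i)) (fun i => S (B.head e, i))
    change s (B.tail e) ≤ s (B.head e) + _ at h2
    change s (B.head e) ≤ s (B.tail e) + _ at h3
    have h4 := hdich (B.tail e)
    have h5 := hdich (B.head e)
    have h6 := hsn (B.tail e)
    have h7 := hsn (B.head e)
    omega
  have hall : ∀ v, 2 * s v₀ < n ↔ 2 * s v < n := by
    intro v
    have hv : B.Reachable v₀ v := hconn.2 v₀ v
    induction hv with
    | refl => exact Iff.rfl
    | tail _ h ih =>
      obtain ⟨e, rfl, rfl⟩ := h
      exact ih.trans (hedge e)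
  have hsum : weight S = ∑ v, s v := weight_eq_sum_fibers S
  -- If all fibres are light, summing shows that `S` has at most half its own weight; if all are
  -- heavy, `S` exceeds half of the cover.
  by_cases h0 : 2 * s v₀ < n
  · have h1 : ∀ v, 2 * Fintype.card V * s v < weight S := by
      intro v
      have h2 := hno v
      have h3 := (hall v).1 h0
      rwa [show min (weight fun i => S (v, i)) (n - weight fun i => S (v, i)) = s v from
        min_eq_left (show s v ≤ n - s v by omega)] at h2
    have h2 := Finset.sum_le_sum fun v (_ : v ∈ Finset.univ) => (h1 v).le
    rw [← Finset.mul_sum, ← hsum, Finset.sum_const, Finset.card_univ, smul_eq_mul] at h2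
    have := Nat.mul_pos hν hS
    nlinarith
  · have h1 : ∀ v, n + 1 ≤ 2 * s v := by
      intro v
      have h2 := hdich v
      have h3 := (hall v).not.1 h0
      have h4 := hsn v
      omega
    have h2 := Finset.sum_le_sum fun v (_ : v ∈ Finset.univ) => h1 v
    rw [← Finset.mul_sum, ← hsum, Finset.sum_const, Finset.card_univ, smul_eq_mul] at h2
    nlinarith

/-- If a cover of a graph that is not bipartite has a cut that almost all edges cross, then some
fibre is neither nearly on one side nor nearly on the other. -/
lemma exists_balanced_fiber_of_uncut (B : MultiGraph V E) (hbip : ¬ B.IsBipartite) {n : ℕ}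
    (σ : B.PermAssignment n) {S : V × Fin n → Bool}
    (hcut : 4 * (B.cover σ).uncutCard S ≤ n) :
    ∃ v, n ≤ 4 * min (weight fun i => S (v, i)) (n - weight fun i => S (v, i)) := by
  set s : V → ℕ := fun v => weight fun i => S (v, i) with hs
  have hsn : ∀ v, s v ≤ n := fun v => weight_le _
  by_contra hno
  push Not at hno
  have hdich : ∀ v, 4 * min (s v) (n - s v) < n := hno
  -- Light against heavy fibres would be a bipartition of `B`.
  refine hbip ⟨fun v => decide (2 * s v < n), fun e => ?_⟩
  have h1 : weight (discrepancy true (σ.1 e)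
      (fun i => S (B.tail e, i)) (fun i => S (B.head e, i))) ≤ (B.cover σ).uncutCard S := by
    rw [cover_uncutCard]
    exact Finset.single_le_sum (f := fun e => weight (discrepancy true (σ.1 e)
      (fun i => S (B.tail e, i)) (fun i => S (B.head e, i)))) (fun _ _ => Nat.zero_le _)
      (Finset.mem_univ e)
  rw [discrepancy_true] at h1
  have h2 := weight_le_weight_add_discrepancy (σ.1 e)
    (fun i => S (B.tail e, i)) (fun i => !S (B.head e, i))
  have h3 := weight_le_weight_add_discrepancy' (σ.1 e)
    (fun i => S (B.tail e, i)) (fun i => !S (B.head e, i))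
  rw [weight_not] at h2 h3
  change s (B.tail e) ≤ n - s (B.head e) + _ at h2
  change n - s (B.head e) ≤ s (B.tail e) + _ at h3
  have h4 := hdich (B.tail e)
  have h5 := hdich (B.head e)
  have h6 := hsn (B.tail e)
  have h7 := hsn (B.head e)
  rw [ne_eq, decide_eq_decide]
  omega

/-! ### From eigenvalues of the cover to nearly preserved colourings -/

variable [DecidableEq V]

lemma exists_small_cut_of_le_eigenvalue (G : MultiGraph V E) {d : ℕ} (hd : 0 < d)
    (hreg : G.IsRegular d) {δ : ℝ} (hδ : 0 < δ) (i : Fin (Fintype.card V)) (hi : (i : ℕ) ≠ 0)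
    (h : d - δ ^ 2 / (8 * d) ≤ G.eigenvalue i) :
    ∃ S : V → Bool, 0 < weight S ∧ 2 * weight S ≤ Fintype.card V ∧
      (G.cutCard S : ℝ) ≤ δ * weight S := by
  obtain ⟨F, hF, hortho⟩ := G.exists_orthonormal_eigenfunctions
  have hanti : Antitone G.eigenvalue := G.adjMatrix_isHermitian.eigenvalues₀_antitone
  let z : Fin (Fintype.card V) := ⟨0, i.pos⟩
  have hiz : i ≠ z := fun h => hi (by rw [h])
  obtain ⟨f, hf, hf0, hsum⟩ := exists_eigenfunction_sum_zero hreg (hF i) (hF z)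
    (by simpa using hortho i i) (by simpa using hortho z z) (by simpa [hiz] using hortho i z)
    (hanti (Fin.mk_le_of_le_val (Nat.zero_le _)))
  exact G.exists_small_cut hd hreg hδ hf h hf0 hsum

lemma exists_small_cut_of_eigenvalue_le_neg (G : MultiGraph V E) {d : ℕ} (hd : 0 < d)
    (hreg : G.IsRegular d) (hbip : G.IsBipartite) {δ : ℝ} (hδ : 0 < δ) (i : Fin (Fintype.card V))
    (hi : (i : ℕ) + 1 ≠ Fintype.card V) (h : d - δ ^ 2 / (8 * d) ≤ -G.eigenvalue i) :
    ∃ S : V → Bool, 0 < weight S ∧ 2 * weight S ≤ Fintype.card V ∧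
      (G.cutCard S : ℝ) ≤ δ * weight S := by
  obtain ⟨F, hF, hortho⟩ := G.exists_orthonormal_eigenfunctions
  have hanti : Antitone G.eigenvalue := G.adjMatrix_isHermitian.eigenvalues₀_antitone
  obtain ⟨c, hc⟩ := hbip
  -- After the sign flip the last eigenvalue becomes the largest, so `z` plays the role that index
  -- zero has for the upper end of the spectrum.
  let z : Fin (Fintype.card V) := ⟨Fintype.card V - 1, by have := i.pos; omega⟩
  have hiz : i ≠ z := fun h => hi (by have := i.pos; rw [h]; simp only [z]; omega)
  have hmul : ∀ a b, ∑ x, (if c x = true then (1 : ℝ) else -1) * F a x *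
      ((if c x = true then (1 : ℝ) else -1) * F b x) = ∑ x, F a x * F b x := fun a b =>
    Finset.sum_congr rfl fun x _ => by split_ifs <;> ring
  obtain ⟨f, hf, hf0, hsum⟩ := exists_eigenfunction_sum_zero hreg ((hF i).mul_sign hc)
    ((hF z).mul_sign hc) (by rw [hmul]; simpa using hortho i i)
    (by rw [hmul]; simpa using hortho z z) (by rw [hmul]; simpa [hiz] using hortho i z)
    (neg_le_neg (hanti (Fin.le_def.2 (by have := i.2; simp only [z]; omega))))
  exact G.exists_small_cut hd hreg hδ hf h hf0 hsum

lemma exists_nearly_preserved_of_eigenvalue (B : MultiGraph V E) {d : ℕ} (hd : 0 < d)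
    (hreg : B.IsRegular d) (hconn : B.IsConnected) {q m₀ : ℕ} (hq : 0 < q) (hm₀ : 0 < m₀) {δ : ℝ}
    (hδ : δ = 1 / (4 * Fintype.card V * q * m₀)) {n : ℕ} (hn : 4 * m₀ ≤ n)
    (σ : B.PermAssignment n)
    (hcomp : ¬ ∃ x, ((B.cover σ).component x).ncard < 2 * Fintype.card V * m₀)
    (i : Fin (Fintype.card (V × Fin n))) (hi : (i : ℕ) ≠ 0)
    (hbip : B.IsBipartite → (i : ℕ) + 1 ≠ Fintype.card (V × Fin n))
    (h : d - (δ ^ 2 / (δ + d)) ^ 2 / (8 * d) ≤ |(B.cover σ).eigenvalue i|) :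
    ∃ (b : Bool) (x : V → Fin n → Bool) (v : V),
      m₀ ≤ min (weight (x v)) (n - weight (x v)) ∧
      ∀ e, q * weight (discrepancy b (σ.1 e) (x (B.tail e)) (x (B.head e))) ≤
        min (weight (x v)) (n - weight (x v)) := by
  have hν : 0 < Fintype.card V := Fintype.card_pos_iff.2 hconn.1
  have hδ0 : 0 < δ := by
    have h1 : (0 : ℝ) < Fintype.card V := by exact_mod_cast hν
    have h2 : (0 : ℝ) < q := by exact_mod_cast hq
    have h3 : (0 : ℝ) < m₀ := by exact_mod_cast hm₀
    rw [hδ]; positivity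
  have hν1 : (1 : ℝ) ≤ Fintype.card V := by exact_mod_cast hν
  have hq1 : (1 : ℝ) ≤ q := by exact_mod_cast hq
  have hm1 : (1 : ℝ) ≤ m₀ := by exact_mod_cast hm₀
  have hδeq : δ * (4 * Fintype.card V * q * m₀) = 1 := by
    rw [hδ]; field_simp
  have hd' : (0 : ℝ) < d := by exact_mod_cast hd
  have hη : (δ ^ 2 / (δ + d)) ^ 2 / (8 * d) ≤ δ ^ 2 / (8 * d) := by
    have : δ ^ 2 / (δ + d) ≤ δ := by
      rw [div_le_iff₀ (by positivity)]; nlinarith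
    gcongr
  have hGreg := B.cover_isRegular hreg σ
  have hcutcase : (∃ S : V × Fin n → Bool, 0 < weight S ∧
      2 * weight S ≤ Fintype.card (V × Fin n) ∧ ((B.cover σ).cutCard S : ℝ) ≤ δ * weight S) →
      ∃ (b : Bool) (x : V → Fin n → Bool) (v : V),
      m₀ ≤ min (weight (x v)) (n - weight (x v)) ∧
      ∀ e, q * weight (discrepancy b (σ.1 e) (x (B.tail e)) (x (B.head e))) ≤
        min (weight (x v)) (n - weight (x v)) := by
    rintro ⟨S, hS, hhalf, hcut⟩
    rw [Fintype.card_prod, Fintype.card_fin] at hhalf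
    have hcut' : 4 * Fintype.card V * q * m₀ * (B.cover σ).cutCard S ≤ weight S := by
      have h1 := mul_le_mul_of_nonneg_left hcut
        (by positivity : (0 : ℝ) ≤ 4 * Fintype.card V * q * m₀)
      have h2 : (4 * Fintype.card V * q * m₀ : ℝ) * (δ * weight S) = weight S := by
        linear_combination (weight S : ℝ) * hδeq
      rw [h2] at h1
      exact_mod_cast h1
    have hcutν : 2 * Fintype.card V * (q * (B.cover σ).cutCard S) ≤ weight S := by
      refine le_trans ?_ hcut'
      calc 2 * Fintype.card V * (q * (B.cover σ).cutCard S)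
          = 2 * Fintype.card V * q * 1 * (B.cover σ).cutCard S := by ring
        _ ≤ 4 * Fintype.card V * q * m₀ * (B.cover σ).cutCard S := by
          gcongr
          · norm_num
          · exact hm₀
    -- If the cut is empty, `S` contains a whole component, which is not small by hypothesis; if
    -- not, a single cut edge already forces this weight by the choice of `δ`.
    have hlarge : 2 * Fintype.card V * m₀ ≤ weight S := by
      by_contra hlt
      push Not at hlt
      have hzero : (B.cover σ).cutCard S = 0 := by
        by_contra hne
        have h1 : 2 * Fintype.card V * m₀ ≤
            4 * Fintype.card V * q * m₀ * (B.cover σ).cutCard S := by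
          calc 2 * Fintype.card V * m₀ = 2 * Fintype.card V * 1 * m₀ * 1 := by ring
            _ ≤ 4 * Fintype.card V * q * m₀ * (B.cover σ).cutCard S := by
              gcongr
              · norm_num
              · exact hq
              · exact Nat.pos_of_ne_zero hne
        omega
      obtain ⟨x, hx⟩ := Finset.card_pos.1 hS
      exact hcomp ⟨x, ((B.cover σ).component_ncard_le_weight hzero
        (Finset.mem_filter.1 hx).2).trans_lt hlt⟩
    obtain ⟨v, hv⟩ := B.exists_balanced_fiber_of_cut hconn σ hS hhalf
      (le_trans (Nat.mul_le_mul_left _ (Nat.le_mul_of_pos_left _ hq)) hcutν)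
    have h2ν : 0 < 2 * Fintype.card V := by omega
    refine ⟨false, fun v i => S (v, i), v,
      Nat.le_of_mul_le_mul_left (hlarge.trans hv) h2ν, fun e => ?_⟩
    refine le_trans (Nat.mul_le_mul_left q ?_)
      (Nat.le_of_mul_le_mul_left (hcutν.trans hv) h2ν)
    rw [cover_cutCard]
    exact Finset.single_le_sum (f := fun e => weight (discrepancy false (σ.1 e)
      (fun i => S (B.tail e, i)) (fun i => S (B.head e, i)))) (fun _ _ => Nat.zero_le _)
      (Finset.mem_univ e)
  by_cases hb : B.IsBipartite
  · refine hcutcase ?_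
    have hGb : (B.cover σ).IsBipartite := by
      obtain ⟨c, hc⟩ := hb
      exact ⟨fun p => c p.1, fun e => hc e.1⟩
    rcases le_abs.1 h with h | h
    · exact (B.cover σ).exists_small_cut_of_le_eigenvalue hd hGreg hδ0 i hi (by linarith)
    · exact (B.cover σ).exists_small_cut_of_eigenvalue_le_neg hd hGreg hGb hδ0 i (hbip hb)
        (by linarith)
  rcases le_abs.1 h with h | h
  · exact hcutcase
      ((B.cover σ).exists_small_cut_of_le_eigenvalue hd hGreg hδ0 i hi (by linarith))
  obtain ⟨F, hF, hortho⟩ := (B.cover σ).exists_orthonormal_eigenfunctions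
  have hFi : F i ≠ 0 := fun h0 => by
    have := hortho i i
    simp [h0] at this
  rcases (B.cover σ).exists_small_cut_or_uncut hd hGreg hδ0 (hF i) (by linarith) hFi with
    h | ⟨S, hS⟩
  · exact hcutcase h
  -- Here the balanced fibre has both colours at least `n / 4` times, so `m₀` is reached because `4
  -- * m₀ ≤ n` and components play no role.
  have hcut : 4 * q * m₀ * (B.cover σ).uncutCard S ≤ n := by
    rw [Fintype.card_prod, Fintype.card_fin, Nat.cast_mul] at hS
    have h1 := mul_le_mul_of_nonneg_left hS (by positivity : (0 : ℝ) ≤ 4 * q * m₀)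
    have h2 : (4 * q * m₀ : ℝ) * (δ * (Fintype.card V * n)) = n := by
      linear_combination (n : ℝ) * hδeq
    rw [h2] at h1
    exact_mod_cast h1
  have hcutq : 4 * (q * (B.cover σ).uncutCard S) ≤ n := by
    refine le_trans ?_ hcut
    calc 4 * (q * (B.cover σ).uncutCard S) = 4 * q * 1 * (B.cover σ).uncutCard S := by ring
      _ ≤ _ := by gcongr; exact hm₀
  obtain ⟨v, hv⟩ := B.exists_balanced_fiber_of_uncut hb σ (S := S)
    (le_trans (Nat.mul_le_mul_left _ (Nat.le_mul_of_pos_left _ hq)) hcutq)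
  refine ⟨true, fun v i => S (v, i), v,
    Nat.le_of_mul_le_mul_left (hn.trans hv) (by norm_num), fun e => ?_⟩
  refine le_trans (Nat.mul_le_mul_left q ?_)
    (Nat.le_of_mul_le_mul_left (hcutq.trans hv) (by norm_num))
  rw [cover_uncutCard]
  exact Finset.single_le_sum (f := fun e => weight (discrepancy true (σ.1 e)
    (fun i => S (B.tail e, i)) (fun i => S (B.head e, i)))) (fun _ _ => Nat.zero_le _)
    (Finset.mem_univ e)

/-- The bad events of both parts have probability `O(n⁻ʲ)`. -/
lemma exists_broderShamir_bad_eigenvalue_le (B : MultiGraph V E) {d : ℕ} (hd : 3 ≤ d)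
    (hreg : B.IsRegular d) (hconn : B.IsConnected) (j : ℕ) :
    ∃ ε C : ℝ, ∃ r : ℕ, 0 < ε ∧ 0 < C ∧ ∀ n : ℕ, 0 < n →
      (B.broderShamir n).real {σ : B.PermAssignment n |
        (¬ ∃ x, ((B.cover σ).component x).ncard < r) ∧
        ∃ i : Fin (Fintype.card (V × Fin n)), (i : ℕ) ≠ 0 ∧
          (B.IsBipartite → (i : ℕ) + 1 ≠ Fintype.card (V × Fin n)) ∧
          (d : ℝ) - ε ≤ |(B.cover σ).eigenvalue i|} ≤ C / (n : ℝ) ^ j := by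
  obtain ⟨q, m₀, n₀, hq, hm₀, hprob⟩ := B.exists_broderShamir_nearly_preserved_le hd hreg j
  have hν : (0 : ℝ) < Fintype.card V := by exact_mod_cast Fintype.card_pos_iff.2 hconn.1
  have hq' : (0 : ℝ) < q := by exact_mod_cast hq
  have hm' : (0 : ℝ) < m₀ := by exact_mod_cast hm₀
  have hd' : (0 : ℝ) < d := by exact_mod_cast (by omega : 0 < d)
  obtain ⟨δ, hδ⟩ : ∃ δ : ℝ, δ = 1 / (4 * Fintype.card V * q * m₀) := ⟨_, rfl⟩
  have hδ0 : 0 < δ := by rw [hδ]; positivity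
  set n₁ : ℕ := max n₀ (4 * m₀)
  -- The summand 2 counts the preserved and reversed cases; `n₁ ^ j` makes the bound exceed 1, hence
  -- trivial, for `n < n₁`.
  refine ⟨(δ ^ 2 / (δ + d)) ^ 2 / (8 * d), 2 + (n₁ : ℝ) ^ j, 2 * Fintype.card V * m₀,
    by positivity, by positivity, fun n hn => ?_⟩
  have hn' : (0 : ℝ) < n := by exact_mod_cast hn
  rcases le_or_gt n₁ n with hle | hlt
  · have hn₀ : n₀ ≤ n := (le_max_left _ _).trans hle
    have hn₄ : 4 * m₀ ≤ n := (le_max_right _ _).trans hle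
    set ev : Bool → Set (B.PermAssignment n) := fun b =>
      {σ | ∃ (x : V → Fin n → Bool) (v : V), m₀ ≤ min (weight (x v)) (n - weight (x v)) ∧
        ∀ e, q * weight (discrepancy b (σ.1 e) (x (B.tail e)) (x (B.head e))) ≤
          min (weight (x v)) (n - weight (x v))}
    refine (measureReal_mono (s₂ := ⋃ b, ev b) ?_ (measure_ne_top _ _)).trans
      ((measureReal_iUnion_fintype_le ev).trans ?_)
    · rintro σ ⟨hcomp, i, hi, hbip, h⟩
      obtain ⟨b, hb⟩ := B.exists_nearly_preserved_of_eigenvalue (by omega) hreg hconn hq hm₀ hδ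
        hn₄ σ hcomp i hi hbip h
      exact Set.mem_iUnion.2 ⟨b, hb⟩
    · rw [Fintype.sum_bool]
      refine (add_le_add (hprob true n hn₀) (hprob false n hn₀)).trans ?_
      rw [← add_div]
      refine div_le_div_of_nonneg_right ?_ (by positivity)
      have : (0 : ℝ) ≤ (n₁ : ℝ) ^ j := by positivity
      linarith
  · refine measureReal_le_one.trans ?_
    rw [le_div_iff₀ (by positivity), one_mul]
    have : (n : ℝ) ^ j ≤ (n₁ : ℝ) ^ j :=
      pow_le_pow_left₀ hn'.le (by exact_mod_cast hlt.le) _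
    linarith

end MultiGraph

theorem mainTheorem10 {V E : Type*} [Fintype V] [DecidableEq V] [Fintype E]
    (B : MultiGraph V E) (d : ℕ) (hd : 3 ≤ d) (hreg : B.IsRegular d) (hconn : B.IsConnected)
    (j : ℕ) (hj : 0 < j) :
    ∃ ε C : ℝ, ∃ r : ℕ, 0 < ε ∧ 0 < C ∧
      (¬ B.IsBipartite → ∀ n : ℕ, 0 < n →
        (B.broderShamir n).real {σ : B.PermAssignment n |
          (¬ ∃ x, ((B.cover σ).component x).ncard < r) ∧
          ∃ i : Fin (Fintype.card (V × Fin n)), (i : ℕ) ≠ 0 ∧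
            (d : ℝ) - ε ≤ |(B.cover σ).eigenvalue i|} ≤ C / (n : ℝ) ^ j) ∧
      (B.IsBipartite → ∀ n : ℕ, 0 < n →
        (B.broderShamir n).real {σ : B.PermAssignment n |
          (¬ ∃ x, ((B.cover σ).component x).ncard < r) ∧
          ∃ i : Fin (Fintype.card (V × Fin n)), (i : ℕ) ≠ 0 ∧
            (i : ℕ) + 1 ≠ Fintype.card (V × Fin n) ∧
            (d : ℝ) - ε ≤ |(B.cover σ).eigenvalue i|} ≤ C / (n : ℝ) ^ j) := by
  obtain ⟨ε, C, r, hε, hC, h⟩ := B.exists_broderShamir_bad_eigenvalue_le hd hreg hconn j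
  refine ⟨ε, C, r, hε, hC, fun hb n hn => ?_, fun _ n hn => ?_⟩
  · refine (measureReal_mono ?_ (measure_ne_top _ _)).trans (h n hn)
    rintro σ ⟨hcomp, i, hi, hev⟩
    exact ⟨hcomp, i, hi, fun hb' => absurd hb' hb, hev⟩
  · refine (measureReal_mono ?_ (measure_ne_top _ _)).trans (h n hn)
    rintro σ ⟨hcomp, i, hi, hlast, hev⟩
    exact ⟨hcomp, i, hi, fun _ => hlast, hev⟩
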